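/- All rings are commutative with $1$ (the zero ring is allowed). A \emph{$ba\ell$-algebra} is an $\mathbb R$-algebra $A$ with a lattice order such that $a\le b$ implies $a+c\le b+c$; $0\le a,b$ implies $0\le ab$; $0\le a\in A$ and $0\le r\in\mathbb R$ imply $0\le ra$; for each $a$ there is $n\in\mathbb N$ with $-n\cdot 1\le a\le n\cdot 1$; and $a\le 0$ whenever there is $b$ with $na\le b$ for all $n\in\mathbb N$. Its norm is $\|a\|=\inf\{r\in\mathbb R: |a|\le r\}$, where $|a|=a\vee(-a)$ (and $\|0\|=0$ in the zero algebra); topological notions in $A$ refer to this norm. Its morphisms are the unital $\ell$-algebra homomorphisms. A \emph{reflexive proximity} on $A$ is a binary relation $\prec$ such that: $a\prec b$ implies $a\le b$; $a\le b\prec c\le d$ implies $a\prec d$; $a\prec b,c$ implies $a\prec b\wedge c$; $a,b\prec c$ implies $a\vee b\prec c$; $a\prec b$ implies that there is $c$ with $c\prec c$ and $a\prec c\prec b$; $a\prec b$ and $c\prec d$ imply $a+c\prec b+d$; if moreover $a,b,c,d\ge 0$, then $ac\prec bd$; $r\prec r$ for each $r\in\mathbb R$; and $a\prec b$ and $0\le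 r\in\mathbb R$ imply $ra\prec rb$. Let $pba\ell$ be the category of pairs $(A,\prec)$ with $A$ a $ba\ell$-algebra and $\prec$ a reflexive proximity on $A$; its morphisms are the unital $\ell$-algebra homomorphisms preserving $\prec$. An \emph{$sbal$-subalgebra} of a $ba\ell$-algebra $A$ is a subset $S$ containing the real constants and closed under $+,\vee,\wedge$ and under products of nonnegative elements. Then $\mathscr B S$ denotes the $\ell$-subalgebra $\{s-t: s,t\in S\}$ of $A$ with the proximity $x\prec_S y\iff \exists s\in S: x\le s\le y$. For $(A,\prec)\in pba\ell$ let $\mathscr R(A,\prec)=\{c\in A: c\prec c\}$, an $sbal$-subalgebra of $A$. Consider the following full subcategories of $pba\ell$, given by conditions on $(A,\prec)$: \begin{itemize} \item $spba\ell$: $A=\mathscr{BR}(A,\prec)$; \item $uspba\ell$: $A=\mathscr{BR}(A,\prec)$ and $\mathscr R(A,\prec)$ is complete in the norm; \item $nba\ell$: $\mathscr{BR}(A,\prec)$ is dense in $A$; \item $unba\ell$: $(A,\prec)\in nba\ell$, $A$ is complete in the norm, and $\prec$ is closed in $A\times A$. \end{itemize} Let $\mathsf{Nach}$ be the category of Nachbin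 spaces (compact spaces $X$ with a partial order closed in $X\times X$) and continuous order-preserving maps. For $X\in\mathsf{Nach}$ let $C_\le(X)\subseteq C(X)$ be the set of order-preserving continuous real functions and let $\mathscr C X=(C(X),\prec_X)$, where $f\prec_X g$ iff $f\le c\le g$ for some $c\in C_\le(X)$; on morphisms, $\mathscr C$ and $\mathscr B\mathscr C_\le: X\mapsto \mathscr B(C_\le(X))$ act by composition. For $(A,\prec)\in nba\ell$ let $\mathscr X(A,\prec)$ be the set of maximal $\ell$-ideals of $A$, with closed sets $\{x: I\subseteq x\}$ for $I$ an $\ell$-ideal, and with $x\le y$ iff every $a\in A$ such that $|a|\le c$ for some $c\in y\cap\mathscr R(A,\prec)$, $c\ge 0$, belongs to $x$; on morphisms, $\mathscr X\alpha=\alpha^{-1}$. This is a contravariant functor $\mathscr X: nba\ell\to\mathsf{Nach}$. \textbf{Corollary.} \begin{enumerate} \item $spba\ell$ is a full subcategory of $nba\ell$. \item $\mathscr X: spba\ell\to\mathsf{Nach}$ and $\mathscr B\mathscr C_\le:\mathsf{Nach}\to spba\ell$ are well defined and form a contravariant adjunction, which restricts to a dual equivalence between $uspba\ell$ and $\mathsf{Nach}$.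 \item $\mathscr C\mathscr X: uspba\ell\to unba\ell$ and $\mathscr{BR}: unba\ell\to uspba\ell$ are well defined and yield an equivalence between $uspba\ell$ and $unba\ell$. \end{enumerate} -/

import Mathlib

open CategoryTheory

universe u

namespace GelfandNachbin

/-! ### Bounded archimedean lattice-ordered algebras -/

/-- `A` is a bounded archimedean `ℓ`-algebra (a `baℓ`-algebra): a commutative unital real algebra
with a lattice order which is translation invariant, with products of nonnegative elements
nonnegative, nonnegative real multiples of nonnegative elements nonnegative, with `1` a strong
order unit, and archimedean. The zero algebra is allowed. -/
class IsBal (A : Type*) [CommRing A] [Lattice A] [Algebra ℝ A] : Prop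
    extends IsOrderedRing A where
  smul_nonneg' : ∀ (r : ℝ) (a : A), 0 ≤ r → 0 ≤ a → 0 ≤ r • a
  bounded : ∀ a : A, ∃ n : ℕ, -(n : A) ≤ a ∧ a ≤ (n : A)
  arch : ∀ a b : A, (∀ n : ℕ, n • a ≤ b) → a ≤ 0

section Norm

variable {A : Type*} [CommRing A] [Algebra ℝ A]

/-- The real number `r` viewed as the element `r · 1` of `A`. -/
abbrev cst (A : Type*) [CommRing A] [Algebra ℝ A] (r : ℝ) : A := algebraMap ℝ A r

lemma cst_add (r s : ℝ) : cst A (r + s) = cst A r + cst A s := map_add _ r s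

lemma cst_zero : cst A 0 = 0 := map_zero _

lemma cst_natCast (n : ℕ) : cst A (n : ℝ) = (n : A) := map_natCast _ n

variable [Lattice A]

/-- The norm `‖a‖ = inf {r ∈ ℝ : |a| ≤ r}` of an element of a `baℓ`-algebra. (In the zero algebra
the set on the right is all of `ℝ`, and the value is `0`.) -/
noncomputable def lnorm (a : A) : ℝ := sInf {r : ℝ | |a| ≤ cst A r}

lemma lnorm_of_subsingleton [Subsingleton A] (a : A) : lnorm a = 0 := by
  have : {r : ℝ | |a| ≤ cst A r} = Set.univ := by
    ext r; simp [(Subsingleton.elim _ _ : |a| = cst A r)]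
  rw [lnorm, this, Real.sInf_univ]

variable [IsBal A]

lemma cst_mono {r s : ℝ} (h : r ≤ s) : cst A r ≤ cst A s := by
  have h1 := IsBal.smul_nonneg' (s - r) (1 : A) (by linarith) zero_le_one
  rw [← Algebra.algebraMap_eq_smul_one, map_sub] at h1
  exact sub_nonneg.mp h1

lemma cst_nonneg {r : ℝ} (h : 0 ≤ r) : 0 ≤ cst A r := by
  simpa using cst_mono (A := A) h

lemma abs_le_nat (a : A) : ∃ n : ℕ, |a| ≤ cst A n := by
  obtain ⟨n, h1, h2⟩ := IsBal.bounded a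
  exact ⟨n, by rw [cst_natCast]; exact sup_le h2 (neg_le.mp h1)⟩

lemma cst_pos_of_nonneg [Nontrivial A] {r : ℝ} (h : 0 ≤ cst A r) : 0 ≤ r := by
  by_contra hr
  push Not at hr
  have h1 : cst A r ≤ 0 := by simpa using cst_mono (A := A) hr.le
  have h2 : cst A r = 0 := le_antisymm h1 h
  have := (FaithfulSMul.algebraMap_injective ℝ A) (h2.trans (map_zero _).symm)
  linarith

lemma lnorm_nonneg (a : A) : 0 ≤ lnorm a := by
  rcases subsingleton_or_nontrivial A with h | h
  · rw [lnorm_of_subsingleton]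
  · exact Real.sInf_nonneg fun r hr => cst_pos_of_nonneg (A := A) ((abs_nonneg a).trans hr)

lemma lnorm_le {a : A} {r : ℝ} (hr : 0 ≤ r) (h : |a| ≤ cst A r) : lnorm a ≤ r := by
  rcases subsingleton_or_nontrivial A with h' | h'
  · rwa [lnorm_of_subsingleton]
  · exact csInf_le ⟨0, fun s hs => cst_pos_of_nonneg (A := A) ((abs_nonneg a).trans hs)⟩ h

lemma abs_le_of_lnorm_lt {a : A} {r : ℝ} (h : lnorm a < r) : |a| ≤ cst A r := by
  obtain ⟨n, hn⟩ := abs_le_nat a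
  obtain ⟨s, hs, hsr⟩ := exists_lt_of_csInf_lt ⟨(n : ℝ), hn⟩ h
  exact le_trans hs (cst_mono hsr.le)

lemma abs_le_lnorm (a : A) : |a| ≤ cst A (lnorm a) := by
  rw [← sub_nonpos]
  refine IsBal.arch _ 1 fun n => ?_
  rcases Nat.eq_zero_or_pos n with rfl | hn
  · simp
  have hn' : (0 : ℝ) < n := by exact_mod_cast hn
  have h1 : |a| ≤ cst A (lnorm a + 1 / n) := abs_le_of_lnorm_lt (by
    have : (0 : ℝ) < 1 / n := by positivity
    linarith)
  rw [cst_add, ← sub_le_iff_le_add'] at h1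
  calc n • (|a| - cst A (lnorm a)) ≤ n • cst A (1 / n) := nsmul_le_nsmul_right h1 n
    _ = 1 := by
      rw [← map_nsmul, nsmul_eq_mul, mul_one_div_cancel hn'.ne', map_one]

variable (A) in
/-- A `baℓ`-algebra as a normed group, with the norm `lnorm`. -/
noncomputable abbrev lNormedAddCommGroup : NormedAddCommGroup A :=
  AddGroupNorm.toNormedAddCommGroup
    { toFun := lnorm
      map_zero' := le_antisymm (lnorm_le le_rfl (by simp)) (lnorm_nonneg _)
      add_le' := fun a b => lnorm_le (add_nonneg (lnorm_nonneg a) (lnorm_nonneg b)) (by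
        rw [cst_add]
        exact (abs_add_le a b).trans (add_le_add (abs_le_lnorm a) (abs_le_lnorm b)))
      neg' := fun a => by simp [lnorm]
      eq_zero_of_map_eq_zero' := fun a h => by
        have h1 := abs_le_lnorm a
        rw [h, cst_zero] at h1
        exact le_antisymm ((le_abs_self a).trans h1)
          (neg_nonpos.mp ((neg_le_abs a).trans h1)) }

/-- Uniform density of a subset of a `baℓ`-algebra (density in the norm topology). -/
def UniformlyDense (s : Set A) : Prop :=
  letI := lNormedAddCommGroup A
  Dense s

/-- Uniform completeness of a subset of a `baℓ`-algebra (completeness in the norm). -/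
def UniformlyComplete (s : Set A) : Prop :=
  letI := lNormedAddCommGroup A
  IsComplete s

/-- A binary relation on a `baℓ`-algebra is closed if it is a closed subset of `A × A`
with respect to the norm topology. -/
def ClosedRel (prec : A → A → Prop) : Prop :=
  letI := lNormedAddCommGroup A
  IsClosed {p : A × A | prec p.1 p.2}

lemma UniformlyDense.exists_close {s : Set A} (hs : UniformlyDense s) (a : A) {ε : ℝ}
    (hε : 0 < ε) : ∃ b ∈ s, |a - b| ≤ cst A ε := by
  let _ := lNormedAddCommGroup A
  obtain ⟨b, hb, h⟩ := Metric.dense_iff.mp hs a ε hε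
  refine ⟨b, h, abs_le_of_lnorm_lt ?_⟩
  rw [Metric.mem_ball, dist_comm, dist_eq_norm] at hb
  exact hb

end Norm

/-! ### Proximities -/

section Proximity

variable {A : Type*} [CommRing A] [Lattice A] [Algebra ℝ A]

/-- A proximity on an `ℓ`-algebra. -/
structure IsProximity (prec : A → A → Prop) : Prop where
  le_of_prec : ∀ a b, prec a b → a ≤ b
  mono : ∀ a b c d, a ≤ b → prec b c → c ≤ d → prec a d
  prec_inf : ∀ a b c, prec a b → prec a c → prec a (b ⊓ c)
  sup_prec : ∀ a b c, prec a c → prec b c → prec (a ⊔ b) c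
  interpolate : ∀ a b, prec a b → ∃ c, prec a c ∧ prec c b
  add : ∀ a b c d, prec a b → prec c d → prec (a + c) (b + d)
  mul : ∀ a b c d, 0 ≤ a → 0 ≤ b → 0 ≤ c → 0 ≤ d → prec a b → prec c d → prec (a * c) (b * d)
  cst_prec : ∀ r : ℝ, prec (cst A r) (cst A r)
  smul : ∀ (r : ℝ) (a b : A), 0 ≤ r → prec a b → prec (r • a) (r • b)

/-- A reflexive proximity: one may interpolate by a reflexive element. -/
structure IsReflexiveProximity (prec : A → A → Prop) : Prop extends IsProximity prec where
  reflexive : ∀ a b, prec a b → ∃ c, prec c c ∧ prec a c ∧ prec c b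

variable (A) in
/-- An `sbal`-subalgebra of a `baℓ`-algebra `A`: a subset containing the real constants, closed
under addition, binary joins and meets, and under products of nonnegative elements. -/
structure SbalSub where
  carrier : Set A
  cst_mem : ∀ r : ℝ, cst A r ∈ carrier
  add_mem : ∀ {a b}, a ∈ carrier → b ∈ carrier → a + b ∈ carrier
  sup_mem : ∀ {a b}, a ∈ carrier → b ∈ carrier → a ⊔ b ∈ carrier
  inf_mem : ∀ {a b}, a ∈ carrier → b ∈ carrier → a ⊓ b ∈ carrier
  mul_mem : ∀ {a b}, 0 ≤ a → 0 ≤ b → a ∈ carrier → b ∈ carrier → a * b ∈ carrier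

namespace SbalSub

/-- The relation `a ≺_S b ↔ ∃ s ∈ S, a ≤ s ≤ b`. -/
def prec (S : SbalSub A) (a b : A) : Prop := ∃ s ∈ S.carrier, a ≤ s ∧ s ≤ b

variable (S : SbalSub A)

lemma exists_shift [IsBal A] (a : A) : ∃ r : ℝ, 0 ≤ r ∧ 0 ≤ a + cst A r := by
  obtain ⟨n, hn, -⟩ := IsBal.bounded a
  refine ⟨n, n.cast_nonneg, ?_⟩
  rw [cst_natCast]
  exact neg_le_iff_add_nonneg.mp hn

variable [IsBal A]

lemma smul_mem {r : ℝ} (hr : 0 ≤ r) {a : A} (ha : a ∈ S.carrier) : r • a ∈ S.carrier := by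
  obtain ⟨s, -, hs⟩ := exists_shift a
  have h1 := S.mul_mem (cst_nonneg hr) hs (S.cst_mem r) (S.add_mem ha (S.cst_mem s))
  have h2 := S.add_mem h1 (S.cst_mem (-(r * s)))
  convert h2 using 1
  rw [Algebra.smul_def, cst, cst, cst, map_neg, map_mul]
  ring

lemma prec_isReflexiveProximity : IsReflexiveProximity S.prec where
  le_of_prec := fun a b ⟨s, _, h1, h2⟩ => h1.trans h2
  mono := fun a b c d h ⟨s, hs, h1, h2⟩ h' => ⟨s, hs, h.trans h1, h2.trans h'⟩
  prec_inf := fun a b c ⟨s, hs, h1, h2⟩ ⟨t, ht, h3, h4⟩ =>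
    ⟨s ⊓ t, S.inf_mem hs ht, le_inf h1 h3, inf_le_inf h2 h4⟩
  sup_prec := fun a b c ⟨s, hs, h1, h2⟩ ⟨t, ht, h3, h4⟩ =>
    ⟨s ⊔ t, S.sup_mem hs ht, sup_le_sup h1 h3, sup_le h2 h4⟩
  interpolate := fun _ _ ⟨s, hs, h1, h2⟩ => ⟨s, ⟨s, hs, h1, le_rfl⟩, ⟨s, hs, le_rfl, h2⟩⟩
  add := fun a b c d ⟨s, hs, h1, h2⟩ ⟨t, ht, h3, h4⟩ =>
    ⟨s + t, S.add_mem hs ht, add_le_add h1 h3, add_le_add h2 h4⟩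
  mul := fun a b c d ha hb hc hd ⟨s, hs, h1, h2⟩ ⟨t, ht, h3, h4⟩ =>
    ⟨s * t, S.mul_mem (ha.trans h1) (hc.trans h3) hs ht,
      mul_le_mul h1 h3 hc (ha.trans h1), mul_le_mul h2 h4 (hc.trans h3) hb⟩
  cst_prec := fun r => ⟨_, S.cst_mem r, le_rfl, le_rfl⟩
  smul := fun r a b hr ⟨s, hs, h1, h2⟩ => by
    refine ⟨r • s, S.smul_mem hr hs, ?_, ?_⟩
    · rw [← sub_nonneg, ← smul_sub]
      exact IsBal.smul_nonneg' _ _ hr (sub_nonneg.mpr h1)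
    · rw [← sub_nonneg, ← smul_sub]
      exact IsBal.smul_nonneg' _ _ hr (sub_nonneg.mpr h2)
  reflexive := fun a b ⟨s, hs, h1, h2⟩ =>
    ⟨s, ⟨s, hs, le_rfl, le_rfl⟩, ⟨s, hs, h1, le_rfl⟩, ⟨s, hs, le_rfl, h2⟩⟩

/-- The `baℓ`-envelope `{a - b : a, b ∈ S}` of an `sbal`-subalgebra `S` of `A`, as a subalgebra
of `A`. -/
def env : Subalgebra ℝ A where
  carrier := {x | ∃ a ∈ S.carrier, ∃ b ∈ S.carrier, a - b = x}
  algebraMap_mem' := fun r =>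
    ⟨cst A r, S.cst_mem r, cst A 0, S.cst_mem 0, by rw [cst_zero, sub_zero]⟩
  add_mem' := by
    rintro _ _ ⟨a, ha, b, hb, rfl⟩ ⟨c, hc, d, hd, rfl⟩
    exact ⟨a + c, S.add_mem ha hc, b + d, S.add_mem hb hd, by ring⟩
  mul_mem' := by
    rintro _ _ ⟨a, ha, b, hb, rfl⟩ ⟨c, hc, d, hd, rfl⟩
    obtain ⟨p, hp, hap⟩ := exists_shift a
    obtain ⟨q, hq, hbq⟩ := exists_shift b
    obtain ⟨p', hp', hcp⟩ := exists_shift c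
    obtain ⟨q', hq', hdq⟩ := exists_shift d
    have ha' : 0 ≤ a + cst A (p + q) := by
      rw [cst_add, ← add_assoc]; exact add_nonneg hap (cst_nonneg hq)
    have hb' : 0 ≤ b + cst A (p + q) := by
      rw [add_comm p, cst_add, ← add_assoc]; exact add_nonneg hbq (cst_nonneg hp)
    have hc' : 0 ≤ c + cst A (p' + q') := by
      rw [cst_add, ← add_assoc]; exact add_nonneg hcp (cst_nonneg hq')
    have hd' : 0 ≤ d + cst A (p' + q') := by
      rw [add_comm p', cst_add, ← add_assoc]; exact add_nonneg hdq (cst_nonneg hp')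
    have ma := S.add_mem ha (S.cst_mem (p + q))
    have mb := S.add_mem hb (S.cst_mem (p + q))
    have mc := S.add_mem hc (S.cst_mem (p' + q'))
    have md := S.add_mem hd (S.cst_mem (p' + q'))
    refine ⟨_, S.add_mem (S.mul_mem ha' hc' ma mc) (S.mul_mem hb' hd' mb md),
      _, S.add_mem (S.mul_mem ha' hd' ma md) (S.mul_mem hb' hc' mb mc), ?_⟩
    ring

lemma le_env {a : A} (ha : a ∈ S.carrier) : a ∈ S.env :=
  ⟨a, ha, cst A 0, S.cst_mem 0, by rw [cst_zero, sub_zero]⟩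

lemma sup_mem_env {x y : A} (hx : x ∈ S.env) (hy : y ∈ S.env) : x ⊔ y ∈ S.env := by
  obtain ⟨a, ha, b, hb, rfl⟩ := hx
  obtain ⟨c, hc, d, hd, rfl⟩ := hy
  refine ⟨_, S.sup_mem (S.add_mem ha hd) (S.add_mem hc hb), _, S.add_mem hb hd, ?_⟩
  rw [sub_eq_add_neg, sup_add]
  congr 1 <;> abel

lemma inf_mem_env {x y : A} (hx : x ∈ S.env) (hy : y ∈ S.env) : x ⊓ y ∈ S.env := by
  obtain ⟨a, ha, b, hb, rfl⟩ := hx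
  obtain ⟨c, hc, d, hd, rfl⟩ := hy
  refine ⟨_, S.inf_mem (S.add_mem ha hd) (S.add_mem hc hb), _, S.add_mem hb hd, ?_⟩
  rw [sub_eq_add_neg, inf_add]
  congr 1 <;> abel

instance : Lattice S.env := Subtype.lattice (fun _ _ => S.sup_mem_env) (fun _ _ => S.inf_mem_env)

lemma coe_sup_env (x y : S.env) : ((x ⊔ y : S.env) : A) = (x : A) ⊔ y := rfl

lemma coe_inf_env (x y : S.env) : ((x ⊓ y : S.env) : A) = (x : A) ⊓ y := rfl

lemma coe_le_env {x y : S.env} : x ≤ y ↔ (x : A) ≤ y := Iff.rfl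

instance : IsBal S.env where
  add_le_add_left := fun a b h c => add_le_add_left (show (a : A) ≤ b from h) (c : A)
  zero_le_one := (zero_le_one : (0 : A) ≤ 1)
  mul_le_mul_of_nonneg_left := fun _ ha _ _ h =>
    mul_le_mul_of_nonneg_left (Subtype.coe_le_coe.mpr h) (Subtype.coe_le_coe.mpr ha)
  mul_le_mul_of_nonneg_right := fun _ ha _ _ h =>
    mul_le_mul_of_nonneg_right (Subtype.coe_le_coe.mpr h) (Subtype.coe_le_coe.mpr ha)
  smul_nonneg' := fun r a hr ha => IsBal.smul_nonneg' r (a : A) hr ha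
  bounded := fun a => IsBal.bounded (a : A)
  arch := fun a b h => IsBal.arch (a : A) b h

/-- An `sbal`-subalgebra `S` of `A`, regarded as an `sbal`-subalgebra of its envelope. -/
def inEnv : SbalSub S.env where
  carrier := {x | (x : A) ∈ S.carrier}
  cst_mem := fun r => S.cst_mem r
  add_mem := fun ha hb => S.add_mem ha hb
  sup_mem := fun ha hb => S.sup_mem ha hb
  inf_mem := fun ha hb => S.inf_mem ha hb
  mul_mem := fun ha hb hA hB => S.mul_mem ha hb hA hB

end SbalSub

/-- The `sbal`-skeleton: the `sbal`-subalgebra of reflexive elements of a proximity. -/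
def IsProximity.skeleton {prec : A → A → Prop} (h : IsProximity prec) : SbalSub A where
  carrier := {c | prec c c}
  cst_mem := h.cst_prec
  add_mem := fun ha hb => h.add _ _ _ _ ha hb
  sup_mem := fun ha hb => h.sup_prec _ _ _ (h.mono _ _ _ _ le_rfl ha le_sup_left)
    (h.mono _ _ _ _ le_rfl hb le_sup_right)
  inf_mem := fun ha hb => h.prec_inf _ _ _ (h.mono _ _ _ _ inf_le_left ha le_rfl)
    (h.mono _ _ _ _ inf_le_right hb le_rfl)
  mul_mem := fun ha hb hA hB => h.mul _ _ _ _ ha ha hb hb hA hB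

end Proximity

/-! ### Proximity `baℓ`-algebras -/

/-- Unital `ℓ`-algebra homomorphisms. -/
structure BalHom (A B : Type*) [CommRing A] [Lattice A] [Algebra ℝ A] [CommRing B] [Lattice B]
    [Algebra ℝ B] extends A →ₐ[ℝ] B where
  map_sup' : ∀ a b : A, toFun (a ⊔ b) = toFun a ⊔ toFun b
  map_inf' : ∀ a b : A, toFun (a ⊓ b) = toFun a ⊓ toFun b

namespace BalHom

variable {A B : Type*} [CommRing A] [Lattice A] [Algebra ℝ A] [CommRing B] [Lattice B]
  [Algebra ℝ B]

lemma map_abs (α : BalHom A B) (a : A) : α.toAlgHom |a| = |α.toAlgHom a| := by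
  have := α.map_sup' a (-a)
  rw [abs, abs, ← map_neg α.toAlgHom]
  exact this

lemma mono (α : BalHom A B) {a b : A} (h : a ≤ b) : α.toAlgHom a ≤ α.toAlgHom b := by
  have := α.map_sup' a b
  rw [sup_eq_right.mpr h] at this
  exact sup_eq_right.mp this.symm

end BalHom

/-- Objects of `pbaℓ`: `baℓ`-algebras with a reflexive proximity. -/
structure Pbal : Type (u + 1) where
  carrier : Type u
  [commRing : CommRing carrier]
  [lattice : Lattice carrier]
  [algebra : Algebra ℝ carrier]
  [isBal : IsBal carrier]
  prec : carrier → carrier → Prop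
  isReflexiveProximity : IsReflexiveProximity prec

attribute [instance] Pbal.commRing Pbal.lattice Pbal.algebra Pbal.isBal

namespace Pbal

/-- Morphisms of `pbaℓ`: unital `ℓ`-algebra homomorphisms preserving the proximity. -/
@[ext]
structure Hom (A B : Pbal.{u}) where
  hom : BalHom A.carrier B.carrier
  map_prec : ∀ a b, A.prec a b → B.prec (hom.toAlgHom a) (hom.toAlgHom b)

/-- The category `pbaℓ`. -/
instance : Category Pbal.{u} where
  Hom := Hom
  id A :=
    { hom := { AlgHom.id ℝ A.carrier with
        map_sup' := fun _ _ => rfl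
        map_inf' := fun _ _ => rfl }
      map_prec := fun _ _ h => h }
  comp {A B C} f g :=
    { hom := { g.hom.toAlgHom.comp f.hom.toAlgHom with
        map_sup' := fun a b =>
          (congrArg g.hom.toFun (f.hom.map_sup' a b)).trans (g.hom.map_sup' _ _)
        map_inf' := fun a b =>
          (congrArg g.hom.toFun (f.hom.map_inf' a b)).trans (g.hom.map_inf' _ _) }
      map_prec := fun a b h => g.map_prec _ _ (f.map_prec _ _ h) }

/-- The `sbal`-skeleton `𝓡(A, ≺) = {c ∈ A : c ≺ c}`. -/
def skel (A : Pbal.{u}) : SbalSub A.carrier := A.isReflexiveProximity.toIsProximity.skeleton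

end Pbal

/-- For an `sbal`-subalgebra `S` of a `baℓ`-algebra `A`, the proximity `baℓ`-algebra
`𝓑 S = {a - b : a, b ∈ S}` with the proximity `x ≺ y ↔ ∃ s ∈ S, x ≤ s ≤ y`. -/
def envelope {A : Type u} [CommRing A] [Lattice A] [Algebra ℝ A] [IsBal A] (S : SbalSub A) :
    Pbal.{u} where
  carrier := S.env
  prec := S.inEnv.prec
  isReflexiveProximity := S.inEnv.prec_isReflexiveProximity

/-- A unital `ℓ`-algebra homomorphism `A → B` carrying `S` into `T` induces `𝓑 S → 𝓑 T`. -/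
def envelopeMap {A B : Type u} [CommRing A] [Lattice A] [Algebra ℝ A] [IsBal A]
    [CommRing B] [Lattice B] [Algebra ℝ B] [IsBal B] {S : SbalSub A} {T : SbalSub B}
    (α : BalHom A B) (h : ∀ s ∈ S.carrier, α.toAlgHom s ∈ T.carrier) :
    envelope S ⟶ envelope T where
  hom :=
    { (α.toAlgHom.comp S.env.val).codRestrict T.env (by
        rintro ⟨_, a, ha, b, hb, rfl⟩
        exact ⟨_, h a ha, _, h b hb, (map_sub α.toAlgHom a b).symm⟩) with
      map_sup' := fun (a b : S.env) => Subtype.ext (α.map_sup' a.1 b.1)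
      map_inf' := fun (a b : S.env) => Subtype.ext (α.map_inf' a.1 b.1) }
  map_prec := by
    rintro a b ⟨s, hs, h1, h2⟩
    exact ⟨⟨α.toAlgHom s, T.le_env (h _ hs)⟩, h _ hs, α.mono h1, α.mono h2⟩

lemma Pbal.Hom.map_skel {A B : Pbal.{u}} (f : A ⟶ B) (s : A.carrier) (hs : s ∈ A.skel.carrier) :
    f.hom.toAlgHom s ∈ B.skel.carrier :=
  f.map_prec s s hs

/-- The functor `𝓑𝓡 : pbaℓ → pbaℓ`. -/
def functorBR : Pbal.{u} ⥤ Pbal.{u} where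
  obj A := envelope A.skel
  map f := envelopeMap f.hom (Pbal.Hom.map_skel f)
  map_id _ := rfl
  map_comp _ _ := rfl

/-- `spbaℓ`: the skeletal proximity `baℓ`-algebras, those with `A = 𝓑𝓡(A, ≺)`. -/
def spbal : ObjectProperty Pbal.{u} := fun A => A.skel.env = ⊤

/-- `nbaℓ`: the proximity `baℓ`-algebras whose proximity is a Nachbin proximity, i.e. such that
`𝓑𝓡(A, ≺)` is uniformly dense in `A`. -/
def nbal : ObjectProperty Pbal.{u} := fun A => UniformlyDense (A.skel.env : Set A.carrier)

/-- `unbaℓ`: the members of `nbaℓ` with `A` uniformly complete and `≺` closed in `A × A`. -/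
def unbal : ObjectProperty Pbal.{u} := fun A =>
  nbal A ∧ UniformlyComplete (Set.univ : Set A.carrier) ∧ ClosedRel A.prec

/-- `uspbaℓ`: the members of `spbaℓ` whose `sbal`-skeleton is uniformly complete. -/
def uspbal : ObjectProperty Pbal.{u} := fun A =>
  spbal A ∧ UniformlyComplete A.skel.carrier

lemma uspbal_le_spbal : uspbal.{u} ≤ spbal := fun _ h => h.1

/-! ### Nachbin spaces -/

/-- Nachbin spaces: compact spaces with a partial order that is closed in the product. -/
structure Nach : Type (u + 1) where
  carrier : Type u
  [topologicalSpace : TopologicalSpace carrier]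
  [partialOrder : PartialOrder carrier]
  [compactSpace : CompactSpace carrier]
  [orderClosed : OrderClosedTopology carrier]

attribute [instance] Nach.topologicalSpace Nach.partialOrder Nach.compactSpace Nach.orderClosed

/-- The category of Nachbin spaces and continuous order-preserving maps. -/
instance : Category Nach.{u} where
  Hom X Y := X.carrier →Co Y.carrier
  id X := ContinuousOrderHom.id X.carrier
  comp f g := ContinuousOrderHom.comp g f

/-! ### The functors `𝓒` and `𝓑𝓒_≤` -/

section ContinuousFunctions

instance (X : Type*) [TopologicalSpace X] [CompactSpace X] : IsBal C(X, ℝ) where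
  add_le_add_left := fun _ _ h c x => add_le_add_left (h x) (c x)
  zero_le_one := fun _ => zero_le_one
  mul_le_mul_of_nonneg_left := fun _ ha _ _ h x => mul_le_mul_of_nonneg_left (h x) (ha x)
  mul_le_mul_of_nonneg_right := fun _ ha _ _ h x => mul_le_mul_of_nonneg_right (h x) (ha x)
  smul_nonneg' := fun _ _ hr ha x => mul_nonneg hr (ha x)
  bounded := fun a => by
    obtain ⟨n, hn⟩ := exists_nat_ge ‖a‖
    have h : ∀ x, |a x| ≤ n := fun x => (a.norm_coe_le_norm x).trans hn
    exact ⟨n, fun x => by simpa using (abs_le.mp (h x)).1, fun x => by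
      simpa using (abs_le.mp (h x)).2⟩
  arch := fun a b h x => by
    by_contra hx
    have hx' : 0 < a x := not_le.mp hx
    obtain ⟨n, hn⟩ := exists_nat_gt (b x / a x)
    have h1 : n • a x ≤ b x := h n x
    rw [div_lt_iff₀ hx', ← nsmul_eq_mul] at hn
    exact absurd hn (not_lt.mpr h1)

variable (X : Type*) [TopologicalSpace X] [CompactSpace X] [PartialOrder X]

/-- `C_≤(X)`: the `sbal`-subalgebra of `C(X)` of continuous order-preserving functions. -/
def monotoneFunctions : SbalSub C(X, ℝ) where
  carrier := {f | Monotone f}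
  cst_mem := fun _ _ _ _ => le_rfl
  add_mem := fun ha hb _ _ h => add_le_add (ha h) (hb h)
  sup_mem := fun ha hb _ _ h => sup_le_sup (ha h) (hb h)
  inf_mem := fun ha hb _ _ h => inf_le_inf (ha h) (hb h)
  mul_mem := fun h0 h0' ha hb _ y h => mul_le_mul (ha h) (hb h) (h0' _) (h0 y)

variable {X} {Y : Type*} [TopologicalSpace Y] [CompactSpace Y] [PartialOrder Y]

/-- Composition with a continuous map, as a morphism `C(Y) → C(X)`. -/
def compHom (φ : C(X, Y)) : BalHom C(Y, ℝ) C(X, ℝ) where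
  __ := ContinuousMap.compRightAlgHom ℝ ℝ φ
  map_sup' := fun _ _ => rfl
  map_inf' := fun _ _ => rfl

lemma compHom_mem (φ : X →Co Y) (s : C(Y, ℝ)) (hs : s ∈ (monotoneFunctions Y).carrier) :
    (compHom φ.toContinuousMap).toAlgHom s ∈ (monotoneFunctions X).carrier :=
  fun _ _ h => hs (φ.monotone' h)

end ContinuousFunctions

/-- The functor `𝓒 : Nach → pbaℓ` (contravariant), `X ↦ (C(X), ≺_X)`, where `f ≺_X g` iff
`f ≤ c ≤ g` for some continuous order-preserving `c`. -/
def functorC : Nach.{u}ᵒᵖ ⥤ Pbal.{u} where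
  obj X :=
    { carrier := C(X.unop.carrier, ℝ)
      prec := (monotoneFunctions X.unop.carrier).prec
      isReflexiveProximity := (monotoneFunctions X.unop.carrier).prec_isReflexiveProximity }
  map φ :=
    { hom := compHom (ContinuousOrderHom.toContinuousMap φ.unop)
      map_prec := fun _ _ ⟨s, hs, h1, h2⟩ =>
        ⟨_, compHom_mem φ.unop s hs, fun _ => h1 _, fun _ => h2 _⟩ }
  map_id _ := rfl
  map_comp _ _ := rfl

/-- The functor `𝓑𝓒_≤ : Nach → pbaℓ` (contravariant), `X ↦ 𝓑(C_≤(X)) ⊆ C(X)`. -/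
def functorBC : Nach.{u}ᵒᵖ ⥤ Pbal.{u} where
  obj X := envelope (monotoneFunctions X.unop.carrier)
  map φ := envelopeMap (compHom (ContinuousOrderHom.toContinuousMap φ.unop))
    (compHom_mem φ.unop)
  map_id _ := rfl
  map_comp _ _ := rfl

/-! ### The space of maximal `ℓ`-ideals -/

section Spectrum

variable {A : Type*} [CommRing A] [Lattice A]

/-- `ℓ`-ideals: ideals `I` such that `|a| ≤ |b|` and `b ∈ I` imply `a ∈ I`. -/
def IsLIdeal (I : Ideal A) : Prop := ∀ a b : A, |a| ≤ |b| → b ∈ I → a ∈ I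

variable (A) in
/-- The set `X_A` of maximal `ℓ`-ideals: the maximal elements among the proper `ℓ`-ideals. -/
def LSpec : Type _ := {x : Ideal A // Maximal (fun I => IsLIdeal I ∧ I ≠ ⊤) x}

namespace LSpec

/-- The set `Z_ℓ(I)` of the maximal `ℓ`-ideals containing `I`. -/
def zeros (I : Ideal A) : Set (LSpec A) := {x | I ≤ x.1}

lemma isLIdeal (x : LSpec A) : IsLIdeal x.1 := x.2.prop.1

lemma ne_top (x : LSpec A) : x.1 ≠ ⊤ := x.2.prop.2

lemma abs_mem (x : LSpec A) [AddLeftMono A] {a : A} (h : a ∈ x.1) : |a| ∈ x.1 :=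
  x.isLIdeal _ _ (by rw [abs_abs]) h

lemma mem_of_abs_le (x : LSpec A) {a b : A} (h : |a| ≤ b) (hb : b ∈ x.1) : a ∈ x.1 :=
  x.isLIdeal _ _ (h.trans (le_abs_self b)) hb

variable [Algebra ℝ A]

lemma cst_mem {x : LSpec A} {r : ℝ} (h : cst A r ∈ x.1) : r = 0 := by
  by_contra hr
  refine x.ne_top ((Ideal.eq_top_iff_one _).mpr ?_)
  have := x.1.mul_mem_left (cst A r⁻¹) h
  rwa [cst, cst, ← map_mul, inv_mul_cancel₀ hr, map_one] at this

variable [IsBal A]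

lemma abs_mul_le_mul (a b : A) : |a * b| ≤ |a| * |b| := by
  have h : ∀ c : A, 0 ≤ c → |c * b| ≤ c * |b| := fun c hc =>
    sup_le (mul_le_mul_of_nonneg_left (le_abs_self b) hc) (by
      rw [← mul_neg]; exact mul_le_mul_of_nonneg_left (neg_le_abs b) hc)
  calc |a * b| = |a⁺ * b + -(a⁻ * b)| := by
        rw [← sub_eq_add_neg, ← sub_mul, posPart_sub_negPart]
    _ ≤ |a⁺ * b| + |-(a⁻ * b)| := abs_add_le _ _
    _ ≤ a⁺ * |b| + a⁻ * |b| := by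
        rw [abs_neg]
        exact add_le_add (h _ (posPart_nonneg a)) (h _ (negPart_nonneg a))
    _ = |a| * |b| := by rw [← add_mul, posPart_add_negPart]

lemma posPart_mul_negPart (a : A) : a⁺ * a⁻ = 0 := by
  obtain ⟨n, h⟩ := abs_le_nat a
  rw [cst_natCast] at h
  have h1 : a⁺ ≤ (n : A) := (sup_le (le_abs_self a) (abs_nonneg a)).trans h
  have h2 : a⁻ ≤ (n : A) := (sup_le (neg_le_abs a) (abs_nonneg a)).trans h
  have h3 := posPart_nonneg a
  have h4 := negPart_nonneg a
  have hn : (0 : A) ≤ n := h3.trans h1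
  have key : ∀ k : ℕ, ∀ u v w : A, 0 ≤ u → 0 ≤ v → u ⊓ v = 0 → 0 ≤ w → w ≤ k • u → w ≤ v →
      w ≤ 0 := by
    intro k
    induction k with
    | zero => intro u v w _ _ _ _ h _; simpa using h
    | succ k ih =>
      intro u v w hu hv huv hw hwu hwv
      refine ih u v w hu hv huv hw ?_ hwv
      have h5 : w - k • u ≤ u := by
        rw [succ_nsmul] at hwu
        exact sub_le_iff_le_add'.mpr hwu
      have h6 : w - k • u ≤ v := (sub_le_self _ (nsmul_nonneg hu k)).trans hwv
      have h7 := le_inf h5 h6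
      rw [huv] at h7
      exact sub_nonpos.mp h7
  have key2 : ∀ k : ℕ, ∀ u v w : A, 0 ≤ u → 0 ≤ v → u ⊓ v = 0 → 0 ≤ w → w ≤ u → w ≤ k • v →
      w ≤ 0 := fun k u v w hu hv huv hw h h' =>
    key k v u w hv hu (by rw [inf_comm, huv]) hw h' h
  have hd : a⁺ ⊓ a⁻ = 0 := posPart_inf_negPart_eq_zero a
  have hd' : n • a⁺ ⊓ a⁻ = 0 := by
    refine le_antisymm ?_ (le_inf (nsmul_nonneg h3 n) h4)
    exact key n a⁺ a⁻ _ h3 h4 hd (le_inf (nsmul_nonneg h3 n) h4) inf_le_left inf_le_right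
  refine le_antisymm ?_ (mul_nonneg h3 h4)
  refine key2 n (n • a⁺) a⁻ _ (nsmul_nonneg h3 n) h4 hd' (mul_nonneg h3 h4) ?_ ?_
  · rw [nsmul_eq_mul, mul_comm]
    exact mul_le_mul_of_nonneg_right h2 h3
  · rw [nsmul_eq_mul]
    exact mul_le_mul_of_nonneg_right h1 h4

lemma exists_one_le (x : LSpec A) {a : A} (ha : a ∉ x.1) :
    ∃ m ∈ x.1, 0 ≤ m ∧ ∃ k : ℕ, 1 ≤ m + k • |a| := by
  let J : Ideal A :=
    { carrier := {b | ∃ m ∈ x.1, 0 ≤ m ∧ ∃ k : ℕ, |b| ≤ m + k • |a|}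
      zero_mem' := ⟨0, x.1.zero_mem, le_rfl, 0, by simp⟩
      add_mem' := by
        rintro b c ⟨m, hm, hm0, k, h⟩ ⟨m', hm', hm0', k', h'⟩
        refine ⟨m + m', x.1.add_mem hm hm', add_nonneg hm0 hm0', k + k', ?_⟩
        calc |b + c| ≤ |b| + |c| := abs_add_le _ _
          _ ≤ (m + k • |a|) + (m' + k' • |a|) := add_le_add h h'
          _ = _ := by rw [add_nsmul]; abel
      smul_mem' := by
        rintro c b ⟨m, hm, hm0, k, h⟩
        obtain ⟨n, hn⟩ := abs_le_nat c
        rw [cst_natCast] at hn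
        refine ⟨n * m, x.1.mul_mem_left _ hm, mul_nonneg n.cast_nonneg hm0, n * k, ?_⟩
        calc |c * b| ≤ |c| * |b| := abs_mul_le_mul c b
          _ ≤ n * |b| := mul_le_mul_of_nonneg_right hn (abs_nonneg b)
          _ ≤ n * (m + k • |a|) := mul_le_mul_of_nonneg_left h n.cast_nonneg
          _ = _ := by rw [mul_add, mul_nsmul', nsmul_eq_mul n] }
  have hxJ : x.1 ≤ J := fun b hb => ⟨|b|, x.abs_mem hb, abs_nonneg b, 0, by simp⟩
  have haJ : a ∈ J := ⟨0, x.1.zero_mem, le_rfl, 1, by simp⟩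
  have hJ : IsLIdeal J := fun b c h ⟨m, hm, hm0, k, h'⟩ => ⟨m, hm, hm0, k, h.trans h'⟩
  have htop : J = ⊤ := by
    by_contra hne
    exact ha (x.2.le_of_ge ⟨hJ, hne⟩ hxJ haJ)
  obtain ⟨m, hm, hm0, k, h⟩ := (Ideal.eq_top_iff_one J).mp htop
  exact ⟨m, hm, hm0, k, (le_abs_self 1).trans h⟩

lemma posPart_mem_or (x : LSpec A) (a : A) : a⁺ ∈ x.1 ∨ a⁻ ∈ x.1 := by
  by_contra! h
  obtain ⟨m, hm, hm0, k, hk⟩ := x.exists_one_le h.1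
  refine h.2 (x.mem_of_abs_le (b := m * a⁻) ?_ (x.1.mul_mem_right _ hm))
  rw [abs_of_nonneg (negPart_nonneg a)]
  have := mul_le_mul_of_nonneg_right hk (negPart_nonneg a)
  rw [abs_of_nonneg (posPart_nonneg a), one_mul, add_mul, nsmul_eq_mul, mul_assoc,
    posPart_mul_negPart, mul_zero, add_zero] at this
  exact this

/-- Each quotient of a `baℓ`-algebra by a maximal `ℓ`-ideal is `ℝ`. -/
lemma exists_residue (x : LSpec A) (a : A) : ∃ r : ℝ, a - cst A r ∈ x.1 := by
  obtain ⟨n, hn⟩ := abs_le_nat a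
  let L : Set ℝ := {t | (a - cst A t)⁻ ∈ x.1}
  have hneg : -(n : ℝ) ∈ L := by
    have : (a - cst A (-(n : ℝ)))⁻ = 0 := by
      rw [negPart_eq_zero, cst, map_neg, sub_neg_eq_add, ← neg_le_iff_add_nonneg']
      exact (neg_le_abs a).trans hn
    change _ ∈ x.1
    rw [this]; exact x.1.zero_mem
  have hup : ∀ t ∈ L, t ≤ n := by
    intro t ht
    by_contra! hlt
    have h1 : cst A (t - n) ≤ (a - cst A t)⁻ := by
      refine le_trans ?_ (neg_le_negPart _)
      rw [cst, map_sub, neg_sub]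
      exact sub_le_sub_left ((le_abs_self a).trans hn) _
    have h2 : cst A (t - n) ∈ x.1 := x.mem_of_abs_le
      (by rwa [abs_of_nonneg (cst_nonneg (by linarith))]) ht
    linarith [cst_mem h2]
  have hbdd : BddAbove L := ⟨n, hup⟩
  have hlow : ∀ s t, s ≤ t → t ∈ L → s ∈ L := by
    intro s t hst ht
    refine x.mem_of_abs_le ?_ ht
    rw [abs_of_nonneg (negPart_nonneg _)]
    exact negPart_anti (sub_le_sub_left (cst_mono hst) a)
  refine ⟨sSup L, ?_⟩
  by_contra hmem
  obtain ⟨m, hm, hm0, k, hk⟩ := x.exists_one_le hmem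
  set r := sSup L
  obtain ⟨ε, hε, hkε⟩ : ∃ ε : ℝ, 0 < ε ∧ k * ε ≤ 1 / 2 := by
    refine ⟨1 / (2 * (k + 1)), by positivity, ?_⟩
    rw [mul_one_div, div_le_div_iff₀ (by positivity) (by norm_num)]
    linarith
  have hL : (a - cst A (r - ε))⁻ ∈ x.1 := by
    obtain ⟨t, ht, htr⟩ := exists_lt_of_lt_csSup ⟨_, hneg⟩ (show r - ε < sSup L by linarith)
    exact hlow _ _ htr.le ht
  have hU : (a - cst A (r + ε))⁺ ∈ x.1 := by
    refine (x.posPart_mem_or _).resolve_right fun h => ?_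
    linarith [le_csSup hbdd (show r + ε ∈ L from h)]
  set p := (a - cst A (r - ε))⁻ with hp
  set q := (a - cst A (r + ε))⁺ with hq
  have hp0 : 0 ≤ p := negPart_nonneg _
  have hq0 : 0 ≤ q := posPart_nonneg _
  have habs : |a - cst A r| ≤ p + q + cst A ε := by
    refine sup_le ?_ ?_
    · have h1 : a - cst A (r + ε) ≤ q := le_posPart _
      rw [cst_add] at h1
      calc a - cst A r = (a - (cst A r + cst A ε)) + cst A ε := by abel
        _ ≤ (p + q) + cst A ε := by
          gcongr
          exact h1.trans (le_add_of_nonneg_left hp0)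
    · have h1 : -(a - cst A (r - ε)) ≤ p := neg_le_negPart _
      rw [sub_eq_add_neg r, cst_add, cst, cst, map_neg] at h1
      calc -(a - cst A r) = -(a - (cst A r + -cst A ε)) + cst A ε := by abel
        _ ≤ (p + q) + cst A ε := by
          gcongr
          exact h1.trans (le_add_of_nonneg_right hq0)
  have h1 : (1 : A) ≤ m + k • (p + q) + cst A (1 / 2) := by
    calc (1 : A) ≤ m + k • |a - cst A r| := hk
      _ ≤ m + k • (p + q + cst A ε) := by gcongr
      _ = m + k • (p + q) + cst A (k * ε) := by
        rw [nsmul_add, ← nsmul_eq_mul, cst, cst, map_nsmul]; abel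
      _ ≤ _ := by gcongr; exact cst_mono hkε
  have h2 : cst A (1 / 2) ≤ m + k • (p + q) := by
    have h3 : (1 : A) = cst A (1 / 2) + cst A (1 / 2) := by
      rw [← cst_add]; norm_num [cst]
    rw [h3] at h1
    exact le_of_add_le_add_right h1
  have h4 : cst A (1 / 2) ∈ x.1 := x.mem_of_abs_le
    (by rwa [abs_of_nonneg (cst_nonneg (by norm_num))])
    (x.1.add_mem hm (nsmul_mem (x.1.add_mem hL hU) k))
  have := cst_mem h4
  norm_num at this

/-- The unique real number `r` with `a + x = r + x` in `A/x`. -/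
noncomputable def res (x : LSpec A) (a : A) : ℝ := (x.exists_residue a).choose

lemma sub_res_mem (x : LSpec A) (a : A) : a - cst A (x.res a) ∈ x.1 :=
  (x.exists_residue a).choose_spec

lemma res_eq {x : LSpec A} {a : A} {r : ℝ} (h : a - cst A r ∈ x.1) : x.res a = r := by
  have h1 := x.1.sub_mem h (x.sub_res_mem a)
  have h2 : a - cst A r - (a - cst A (x.res a)) = cst A (x.res a - r) := by
    rw [cst, cst, cst, map_sub]; abel
  rw [h2] at h1
  linarith [cst_mem h1]

lemma res_eq_zero {x : LSpec A} {a : A} : x.res a = 0 ↔ a ∈ x.1 := by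
  constructor
  · intro h
    have := x.sub_res_mem a
    rwa [h, cst_zero, sub_zero] at this
  · intro h
    exact res_eq (by rwa [cst_zero, sub_zero])

lemma res_cst (x : LSpec A) (r : ℝ) : x.res (cst A r) = r := res_eq (by simp)

lemma res_add (x : LSpec A) (a b : A) : x.res (a + b) = x.res a + x.res b := by
  refine res_eq ?_
  have := x.1.add_mem (x.sub_res_mem a) (x.sub_res_mem b)
  convert this using 1
  rw [cst_add]; abel

lemma res_neg (x : LSpec A) (a : A) : x.res (-a) = -x.res a := by
  have := x.res_add a (-a)
  rw [add_neg_cancel, res_eq_zero.mpr x.1.zero_mem] at this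
  linarith

lemma res_sub (x : LSpec A) (a b : A) : x.res (a - b) = x.res a - x.res b := by
  rw [sub_eq_add_neg, res_add, res_neg, sub_eq_add_neg]

lemma res_mul (x : LSpec A) (a b : A) : x.res (a * b) = x.res a * x.res b := by
  refine res_eq ?_
  have := x.1.add_mem (x.1.mul_mem_right b (x.sub_res_mem a))
    (x.1.mul_mem_left (cst A (x.res a)) (x.sub_res_mem b))
  convert this using 1
  rw [cst, cst, cst, map_mul]; ring

lemma res_nonneg (x : LSpec A) {a : A} (h : 0 ≤ a) : 0 ≤ x.res a := by
  by_contra! hr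
  have h1 : |cst A (x.res a)| ≤ a - cst A (x.res a) := by
    have h0 : cst A (x.res a) ≤ 0 := by simpa using cst_mono (A := A) hr.le
    rw [abs_of_nonpos h0, sub_eq_add_neg]
    exact le_add_of_nonneg_left h
  linarith [cst_mem (x.mem_of_abs_le h1 (x.sub_res_mem a))]

lemma res_mono (x : LSpec A) {a b : A} (h : a ≤ b) : x.res a ≤ x.res b := by
  have := x.res_nonneg (sub_nonneg.mpr h)
  rw [res_sub] at this
  linarith

lemma res_posPart (x : LSpec A) (a : A) : x.res a⁺ = max (x.res a) 0 := by
  have h0 := x.res_nonneg (posPart_nonneg a)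
  have h1 := x.res_mono (le_posPart a)
  rcases x.posPart_mem_or a with h | h
  · rw [res_eq_zero.mpr h] at h1 ⊢
    rw [max_eq_right h1]
  · have h2 : x.res a = x.res a⁺ - x.res a⁻ := by rw [← res_sub, posPart_sub_negPart]
    rw [res_eq_zero.mpr h, sub_zero] at h2
    rw [h2, max_eq_left h0]

lemma res_abs (x : LSpec A) (a : A) : x.res |a| = |x.res a| := by
  have h1 : |a| = a⁺ + (-a)⁺ := by rw [posPart_neg, posPart_add_negPart]
  rw [h1, res_add, res_posPart, res_posPart, res_neg]
  rcases le_total 0 (x.res a) with h | h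
  · rw [max_eq_left h, max_eq_right (by linarith), abs_of_nonneg h, add_zero]
  · rw [max_eq_right h, max_eq_left (by linarith), abs_of_nonpos h, zero_add]

lemma maximal_of_residue {I : Ideal A} (h1 : IsLIdeal I) (h2 : I ≠ ⊤)
    (h3 : ∀ a : A, ∃ r : ℝ, a - cst A r ∈ I) : Maximal (fun I => IsLIdeal I ∧ I ≠ ⊤) I := by
  refine ⟨⟨h1, h2⟩, fun J hJ hIJ a ha => ?_⟩
  obtain ⟨r, hr⟩ := h3 a
  have h4 : cst A r ∈ J := by
    have := J.sub_mem ha (hIJ hr)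
    rwa [sub_sub_cancel] at this
  by_cases h0 : r = 0
  · rwa [h0, cst_zero, sub_zero] at hr
  · refine absurd ((Ideal.eq_top_iff_one _).mpr ?_) hJ.2
    have := J.mul_mem_left (cst A r⁻¹) h4
    rwa [cst, cst, ← map_mul, inv_mul_cancel₀ h0, map_one] at this

/-- The topology of `X_A`, whose closed sets are exactly the sets `Z_ℓ(I)`, for `I` an
`ℓ`-ideal. -/
instance : TopologicalSpace (LSpec A) :=
  TopologicalSpace.ofClosed {Z | ∃ I : Ideal A, IsLIdeal I ∧ zeros I = Z}
    ⟨⊤, fun _ _ _ _ => trivial, by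
      ext x
      simpa [zeros] using x.ne_top⟩
    (by
      intro F hF
      refine ⟨⨅ x ∈ ⋂₀ F, (x : LSpec A).1, ?_, ?_⟩
      · intro a b h hb
        simp only [Ideal.mem_iInf] at hb ⊢
        exact fun x hx => x.isLIdeal _ _ h (hb x hx)
      · refine Set.Subset.antisymm (fun y hy Z hZ => ?_) fun y hy =>
          show _ ≤ y.1 from iInf₂_le y hy
        obtain ⟨I, -, rfl⟩ := hF hZ
        exact (le_iInf₂ fun x (hx : x ∈ ⋂₀ F) => hx _ hZ : I ≤ _).trans hy)
    (by
      rintro _ ⟨I, hI, rfl⟩ _ ⟨J, hJ, rfl⟩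
      refine ⟨I ⊓ J, fun a b h hb => ⟨hI _ _ h hb.1, hJ _ _ h hb.2⟩, ?_⟩
      refine Set.Subset.antisymm (fun x hx => ?_) ?_
      · by_contra! hcon
        rw [Set.mem_union, not_or] at hcon
        obtain ⟨a, ha, hax⟩ := Set.not_subset.mp hcon.1
        obtain ⟨b, hb, hbx⟩ := Set.not_subset.mp hcon.2
        have : a * b ∈ x.1 := hx ⟨I.mul_mem_right _ ha, J.mul_mem_left _ hb⟩
        rw [← res_eq_zero, res_mul, mul_eq_zero, res_eq_zero, res_eq_zero] at this
        exact this.elim hax hbx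
      · rintro x (hx | hx)
        · exact (inf_le_left : I ⊓ J ≤ I).trans hx
        · exact (inf_le_right : I ⊓ J ≤ J).trans hx)

lemma isClosed_iff {Z : Set (LSpec A)} :
    IsClosed Z ↔ ∃ I : Ideal A, IsLIdeal I ∧ zeros I = Z := by
  rw [← isOpen_compl_iff]
  change Zᶜᶜ ∈ {Z | ∃ I : Ideal A, IsLIdeal I ∧ zeros I = Z} ↔ _
  rw [compl_compl]; rfl

/-- The sets `{x : a ∈ x}` are closed. -/
lemma isClosed_mem (a : A) : IsClosed {x : LSpec A | a ∈ x.1} := by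
  rw [isClosed_iff]
  refine ⟨⨅ x ∈ {x : LSpec A | a ∈ x.1}, (x : LSpec A).1, fun b c h hc => ?_, ?_⟩
  · simp only [Ideal.mem_iInf] at hc ⊢
    exact fun x hx => x.isLIdeal _ _ h (hc x hx)
  · refine Set.Subset.antisymm (fun y hy => hy ?_) fun y hy =>
      show _ ≤ y.1 from iInf₂_le y hy
    simp only [Ideal.mem_iInf]
    exact fun x hx => hx

lemma isClosed_res_le (a : A) (r : ℝ) : IsClosed {x : LSpec A | x.res a ≤ r} := by
  convert isClosed_mem (a - cst A r)⁺ using 1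
  ext x
  rw [Set.mem_ofPred_eq, Set.mem_ofPred_eq, ← res_eq_zero, res_posPart, res_sub, res_cst]
  simp

lemma isClosed_le_res (a : A) (r : ℝ) : IsClosed {x : LSpec A | r ≤ x.res a} := by
  convert isClosed_res_le (-a) (-r) using 1
  ext x
  simp [res_neg]

lemma abs_res_le (a : A) : ∃ n : ℕ, ∀ x : LSpec A, |x.res a| ≤ n := by
  obtain ⟨n, hn⟩ := abs_le_nat a
  refine ⟨n, fun x => ?_⟩
  have := x.res_mono hn
  rwa [res_abs, res_cst] at this

open Filter Topology in
instance : CompactSpace (LSpec A) := by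
  refine ⟨isCompact_iff_ultrafilter_le_nhds.mpr fun F _ => ?_⟩
  let I : Ideal A :=
    { carrier := {a | Tendsto (fun x : LSpec A => x.res a) F (𝓝 0)}
      zero_mem' := by
        simp only [Set.mem_ofPred_eq, fun x : LSpec A => res_eq_zero.mpr x.1.zero_mem]
        exact tendsto_const_nhds
      add_mem' := by
        intro a b (ha : Tendsto _ _ _) (hb : Tendsto _ _ _)
        simpa [res_add] using ha.add hb
      smul_mem' := by
        intro c a (ha : Tendsto _ _ _)
        obtain ⟨n, hn⟩ := abs_res_le c
        change Tendsto (fun x : LSpec A => x.res (c * a)) F (𝓝 0)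
        refine squeeze_zero_norm (a := fun x => n * |x.res a|) (fun x => ?_) ?_
        · rw [res_mul, Real.norm_eq_abs, abs_mul]
          exact mul_le_mul_of_nonneg_right (hn x) (abs_nonneg _)
        · simpa using ha.abs.const_mul (n : ℝ) }
  have hI : IsLIdeal I := by
    intro a b h (hb : Tendsto _ _ _)
    change Tendsto (fun x : LSpec A => x.res a) F (𝓝 0)
    refine squeeze_zero_norm (a := fun x => |x.res b|) (fun x => ?_) (by simpa using hb.abs)
    rw [Real.norm_eq_abs, ← res_abs, ← res_abs]
    exact x.res_mono h
  have hI' : I ≠ ⊤ := by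
    intro h
    have h1 : Tendsto (fun x : LSpec A => x.res 1) F (𝓝 0) := (Ideal.eq_top_iff_one I).mp h
    have h2 : ∀ x : LSpec A, x.res 1 = 1 := fun x => by
      have := x.res_cst 1
      rwa [cst, map_one] at this
    simp only [h2] at h1
    exact one_ne_zero (tendsto_nhds_unique tendsto_const_nhds h1)
  have hres : ∀ a : A, ∃ r : ℝ, a - cst A r ∈ I := by
    intro a
    obtain ⟨n, hn⟩ := abs_res_le a
    have hF : Set.Icc (-(n : ℝ)) n ∈ F.map (fun x : LSpec A => x.res a) :=
      Filter.mem_map.mpr (Filter.mem_of_superset Filter.univ_mem fun x _ => abs_le.mp (hn x))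
    obtain ⟨r, -, hr⟩ := isCompact_Icc.ultrafilter_le_nhds' _ hF
    refine ⟨r, ?_⟩
    have h1 : Tendsto (fun x : LSpec A => x.res a) F (𝓝 r) := hr
    change Tendsto (fun x : LSpec A => x.res (a - cst A r)) F (𝓝 0)
    simpa [res_sub, res_cst] using h1.sub_const r
  let p : LSpec A := ⟨I, maximal_of_residue hI hI' hres⟩
  refine ⟨p, trivial, ?_⟩
  rw [le_nhds_iff]
  intro s hs hso
  by_contra hsF
  have hc : sᶜ ∈ F := Ultrafilter.compl_mem_iff_notMem.mpr hsF
  obtain ⟨J, -, hJs⟩ := isClosed_iff.mp hso.isClosed_compl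
  have : p ∈ sᶜ := by
    rw [← hJs]
    intro a ha
    change Tendsto (fun x : LSpec A => x.res a) F (𝓝 0)
    refine tendsto_const_nhds.congr' ?_
    filter_upwards [hc] with x hx
    rw [← hJs] at hx
    exact (res_eq_zero.mpr (hx ha)).symm
  exact this hs

variable {B : Type*} [CommRing B] [Lattice B] [Algebra ℝ B] [IsBal B]

/-- The map `X_B → X_A`, `x ↦ α⁻¹(x)`, induced by `α : A → B`. -/
def comap (α : BalHom A B) (x : LSpec B) : LSpec A :=
  ⟨x.1.comap α.toAlgHom, maximal_of_residue
    (fun a b h hb => x.isLIdeal _ _ (by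
      rw [← α.map_abs, ← α.map_abs]; exact α.mono h) hb)
    (by rw [Ne, Ideal.comap_eq_top_iff]; exact x.ne_top)
    (fun a => ⟨x.res (α.toAlgHom a), by
      rw [Ideal.mem_comap, map_sub, AlgHom.commutes]
      exact x.sub_res_mem _⟩)⟩

lemma continuous_comap (α : BalHom A B) : Continuous (comap α) := by
  refine continuous_iff_isClosed.mpr fun Z hZ => ?_
  obtain ⟨I, -, rfl⟩ := isClosed_iff.mp hZ
  have : comap α ⁻¹' zeros I = ⋂ a ∈ I, {x : LSpec B | α.toAlgHom a ∈ x.1} := by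
    ext x
    simp only [Set.mem_iInter]
    exact Iff.rfl
  rw [this]
  exact isClosed_biInter fun a _ => isClosed_mem _

end LSpec

end Spectrum

/-! ### The functor `𝓧` -/

namespace Pbal

/-- The `ℓ`-ideal `↡y = {a ∈ A : |a| ≤ c for some c ∈ y ∩ 𝓡(A, ≺)⁺}`, as a set. -/
def down (A : Pbal.{u}) (y : LSpec A.carrier) : Set A.carrier :=
  {a | ∃ c ∈ y.1, c ∈ A.skel.carrier ∧ 0 ≤ c ∧ |a| ≤ c}

lemma posPart_mem_skel (A : Pbal.{u}) {c : A.carrier} (hc : c ∈ A.skel.carrier) (r : ℝ) :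
    (c - cst A.carrier r)⁺ ∈ A.skel.carrier := by
  have := A.skel.sup_mem (A.skel.add_mem hc (A.skel.cst_mem (-r))) (A.skel.cst_mem 0)
  rwa [cst_zero, cst, map_neg, ← sub_eq_add_neg] at this

lemma res_le_of_down {A : Pbal.{u}} {x y : LSpec A.carrier} (h : A.down y ⊆ x.1)
    {c : A.carrier} (hc : c ∈ A.skel.carrier) : x.res c ≤ y.res c := by
  have h1 : (c - cst A.carrier (y.res c))⁺ ∈ x.1 := by
    refine h ⟨_, ?_, A.posPart_mem_skel hc (y.res c), posPart_nonneg _, ?_⟩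
    · rw [← LSpec.res_eq_zero, LSpec.res_posPart, LSpec.res_sub, LSpec.res_cst]
      simp
    · rw [abs_of_nonneg (posPart_nonneg _)]
  rw [← LSpec.res_eq_zero, LSpec.res_posPart, LSpec.res_sub, LSpec.res_cst] at h1
  simpa using h1

lemma down_subset_iff {A : Pbal.{u}} {x y : LSpec A.carrier} :
    A.down y ⊆ x.1 ↔ ∀ c ∈ A.skel.carrier, x.res c ≤ y.res c := by
  refine ⟨fun h c hc => res_le_of_down h hc, ?_⟩
  rintro h a ⟨c, hcy, hc, hc0, hac⟩
  refine x.mem_of_abs_le hac ?_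
  rw [← LSpec.res_eq_zero] at hcy ⊢
  exact le_antisymm (hcy ▸ h c hc) (x.res_nonneg hc0)

/-- The order of `X_A`: `x ≤ y` iff `↡y ⊆ x`. -/
abbrev specPartialOrder (A : Pbal.{u}) (hA : nbal A) : PartialOrder (LSpec A.carrier) where
  le x y := A.down y ⊆ x.1
  le_refl x := down_subset_iff.mpr fun _ _ => le_rfl
  le_trans x y z h h' := down_subset_iff.mpr fun c hc =>
    (res_le_of_down h hc).trans (res_le_of_down h' hc)
  le_antisymm x y h h' := by
    have h1 : ∀ c ∈ A.skel.carrier, x.res c = y.res c := fun c hc =>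
      le_antisymm (res_le_of_down h hc) (res_le_of_down h' hc)
    have h2 : ∀ a, x.res a = y.res a := by
      intro a
      refine eq_of_forall_dist_le fun ε hε => ?_
      obtain ⟨_, ⟨c, hc, d, hd, rfl⟩, hb⟩ :=
        UniformlyDense.exists_close hA a (half_pos hε)
      have h3 := x.res_mono hb
      have h4 := y.res_mono hb
      rw [LSpec.res_abs, LSpec.res_sub, LSpec.res_cst, LSpec.res_sub] at h3 h4
      rw [h1 c hc, h1 d hd] at h3
      rw [Real.dist_eq]
      rw [abs_le] at h3 h4 ⊢
      constructor <;> linarith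
    refine Subtype.ext (Ideal.ext fun a => ?_)
    rw [← LSpec.res_eq_zero, ← LSpec.res_eq_zero, h2 a]

/-- The Nachbin space `X_A` of a `baℓ`-algebra with a Nachbin proximity. -/
def spec (A : Pbal.{u}) (hA : nbal A) : Nach.{u} :=
  letI := A.specPartialOrder hA
  { carrier := LSpec A.carrier
    orderClosed := ⟨by
      have : {p : LSpec A.carrier × LSpec A.carrier | p.1 ≤ p.2} =
          ⋂ c ∈ A.skel.carrier, ⋂ r : ℝ,
            ({x : LSpec A.carrier | x.res c ≤ r} ×ˢ Set.univ ∪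
              Set.univ ×ˢ {y : LSpec A.carrier | r ≤ y.res c}) := by
        ext ⟨x, y⟩
        simp only [Set.mem_iInter, Set.mem_union, Set.mem_prod, Set.mem_univ, and_true,
          true_and, Set.mem_ofPred_eq]
        refine down_subset_iff.trans (forall₂_congr fun c _ => ?_)
        refine ⟨fun h r => (le_total (x.res c) r).imp_right fun h' => h'.trans h, fun h => ?_⟩
        by_contra! hlt
        obtain ⟨r, h1, h2⟩ := exists_between hlt
        exact (h r).elim (fun h' => absurd h' (not_le.mpr h2))
          (fun h' => absurd h' (not_le.mpr h1))
      rw [this]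
      exact isClosed_biInter fun c _ => isClosed_iInter fun r =>
        ((LSpec.isClosed_res_le c r).prod isClosed_univ).union
          (isClosed_univ.prod (LSpec.isClosed_le_res c r))⟩ }

/-- The morphism `X_B → X_A`, `x ↦ α⁻¹(x)`, induced by `α : A → B`. -/
def specMap {A B : Pbal.{u}} (hA : nbal A) (hB : nbal B) (α : A ⟶ B) :
    B.spec hB ⟶ A.spec hA where
  toFun := LSpec.comap α.hom
  monotone' := by
    intro x y h a ⟨c, hcy, hc, hc0, hac⟩
    refine h ⟨α.hom.toAlgHom c, hcy, α.map_skel c hc, ?_, ?_⟩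
    · rw [← map_zero α.hom.toAlgHom]
      exact α.hom.mono hc0
    · rw [← α.hom.map_abs]
      exact α.hom.mono hac
  continuous_toFun := LSpec.continuous_comap α.hom

end Pbal

/-- The functor `𝓧 : nbaℓ → Nach` (contravariant). -/
def functorX : nbal.{u}.FullSubcategory ⥤ Nach.{u}ᵒᵖ where
  obj A := Opposite.op (A.obj.spec A.property)
  map {A B} α := Quiver.Hom.op (Pbal.specMap A.property B.property α.hom)
  map_id _ := rfl
  map_comp _ _ := rfl

end GelfandNachbin

open GelfandNachbin

/-! The residue map of a maximal `ℓ`-ideal turns each `a` into a continuous function on `X_A`, and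
the archimedean axiom makes this Gelfand representation an order embedding (`LSpec.le_iff_res_le`).
Norm estimates can thus be checked pointwise. The order of `X_A` is the one determined by the
reflexive elements, so these become order-preserving functions.

On the topological side three facts are needed about a Nachbin space `X`. Order-preserving functions
determine its order (`exists_monotone_separating`, an ordered Urysohn argument). An
`sbal`-subalgebra of `C(X)` that determines the order is uniformly dense in `C_≤(X)`
(`SbalSub.exists_near_monotone`). And `f ≺_X g` holds exactly when `f x ≤ g y` for all `x ≤ y`
(`monotoneFunctions_prec_iff`), which makes `≺_X` closed.

If the skeleton of a skeletal `A` is complete, its image is therefore all of `C_≤(X_A)`, and `A →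
𝓑𝓒_≤𝓧(A)` is an isomorphism (`Pbal.isIso_toBC`). In the other direction every maximal `ℓ`-ideal of
`𝓑𝓒_≤(X)` is the ideal of a point, so `X → 𝓧𝓑𝓒_≤(X)` is always an isomorphism (`Nach.isIso_toSpec`).
These maps are the unit and counit of the adjunction, which gives the dual equivalence.

For `unbaℓ`, completeness of `A` and closedness of `≺` make `A → 𝓒𝓧(A)` an isomorphism
(`Pbal.isIso_toC`), so `𝓒` is essentially surjective. Since `𝓑𝓡𝓒 ≅ 𝓑𝓒_≤` is an equivalence and `𝓑𝓡`
is faithful on `unbaℓ` by density, `𝓒` is also fully faithful. Composing the two equivalences gives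
the last claim. -/

namespace GelfandNachbin

/-! ### Order-theoretic forms of the topological notions -/

section UniformCriteria

variable {A : Type*} [CommRing A] [Algebra ℝ A] [Lattice A] [IsBal A]

lemma uniformlyDense_iff {s : Set A} :
    UniformlyDense s ↔ ∀ a : A, ∀ ε : ℝ, 0 < ε → ∃ b ∈ s, |a - b| ≤ cst A ε := by
  refine ⟨fun h a ε hε => h.exists_close a hε, fun h => ?_⟩
  let _ := lNormedAddCommGroup A
  refine Metric.dense_iff.mpr fun a ε hε => ?_
  -- The order bound only yields a non-strict norm bound, while balls are open; halving `ε` restores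
  -- strictness here and below.
  obtain ⟨b, hb, hab⟩ := h a (ε / 2) (half_pos hε)
  refine ⟨b, ?_, hb⟩
  rw [Metric.mem_ball, dist_comm, dist_eq_norm]
  exact (lnorm_le (half_pos hε).le hab).trans_lt (half_lt_self hε)

lemma uniformlyComplete_iff {s : Set A} :
    UniformlyComplete s ↔ ∀ u : ℕ → A, (∀ n, u n ∈ s) →
      (∀ ε : ℝ, 0 < ε → ∃ N, ∀ m ≥ N, ∀ n ≥ N, |u m - u n| ≤ cst A ε) →
      ∃ a ∈ s, ∀ ε : ℝ, 0 < ε → ∃ N, ∀ n ≥ N, |u n - a| ≤ cst A ε := by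
  let _ := lNormedAddCommGroup A
  constructor
  · intro h u hu hc
    have hcau : CauchySeq u := Metric.cauchySeq_iff.mpr fun ε hε => by
      obtain ⟨N, hN⟩ := hc (ε / 2) (half_pos hε)
      refine ⟨N, fun m hm n hn => ?_⟩
      rw [dist_eq_norm]
      exact (lnorm_le (half_pos hε).le (hN m hm n hn)).trans_lt (half_lt_self hε)
    obtain ⟨a, ha, hlim⟩ := cauchySeq_tendsto_of_isComplete h hu hcau
    refine ⟨a, ha, fun ε hε => ?_⟩
    obtain ⟨N, hN⟩ := Metric.tendsto_atTop.mp hlim ε hε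
    refine ⟨N, fun n hn => abs_le_of_lnorm_lt ?_⟩
    have := hN n hn
    rwa [dist_eq_norm] at this
  · intro h
    refine completeSpace_coe_iff_isComplete.mp (Metric.complete_of_cauchySeq_tendsto fun u hu => ?_)
    obtain ⟨a, ha, hlim⟩ := h (fun n => u n) (fun n => (u n).2) fun ε hε => by
      obtain ⟨N, hN⟩ := Metric.cauchySeq_iff.mp hu ε hε
      refine ⟨N, fun m hm n hn => abs_le_of_lnorm_lt ?_⟩
      have := hN m hm n hn
      rwa [Subtype.dist_eq, dist_eq_norm] at this
    refine ⟨⟨a, ha⟩, Metric.tendsto_atTop.mpr fun ε hε => ?_⟩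
    obtain ⟨N, hN⟩ := hlim (ε / 2) (half_pos hε)
    refine ⟨N, fun n hn => ?_⟩
    rw [Subtype.dist_eq, dist_eq_norm]
    exact (lnorm_le (half_pos hε).le (hN n hn)).trans_lt (half_lt_self hε)

lemma closedRel_iff {prec : A → A → Prop} :
    ClosedRel prec ↔ ∀ a b : A, (∀ ε : ℝ, 0 < ε → ∃ a' b', prec a' b' ∧
      |a - a'| ≤ cst A ε ∧ |b - b'| ≤ cst A ε) → prec a b := by
  let _ := lNormedAddCommGroup A
  have key : ClosedRel prec ↔ ∀ p : A × A, p ∈ closure {p : A × A | prec p.1 p.2} →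
      prec p.1 p.2 := closure_subset_iff_isClosed.symm
  rw [key, Prod.forall]
  refine forall₂_congr fun a b => imp_congr_left ?_
  rw [Metric.mem_closure_iff]
  constructor
  · intro h ε hε
    obtain ⟨p, hp, hd⟩ := h ε hε
    rw [Prod.dist_eq, max_lt_iff, dist_eq_norm, dist_eq_norm] at hd
    exact ⟨p.1, p.2, hp, abs_le_of_lnorm_lt hd.1, abs_le_of_lnorm_lt hd.2⟩
  · intro h ε hε
    obtain ⟨a', b', hp, h1, h2⟩ := h (ε / 2) (half_pos hε)
    refine ⟨(a', b'), hp, ?_⟩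
    rw [Prod.dist_eq, max_lt_iff, dist_eq_norm, dist_eq_norm]
    exact ⟨(lnorm_le (half_pos hε).le h1).trans_lt (half_lt_self hε),
      (lnorm_le (half_pos hε).le h2).trans_lt (half_lt_self hε)⟩

end UniformCriteria

/-! ### Maximal `ℓ`-ideals determine the order -/

namespace LSpec

variable {A : Type*} [CommRing A] [Lattice A]

/-- Zorn's lemma: the union of a nonempty chain of proper `ℓ`-ideals is an `ℓ`-ideal and still omits
`1`. -/
lemma exists_le_of_isLIdeal {I : Ideal A} (hI : IsLIdeal I) (hI' : I ≠ ⊤) :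
    ∃ x : LSpec A, I ≤ x.1 := by
  obtain ⟨M, hIM, hM⟩ := zorn_le_nonempty₀ {I : Ideal A | IsLIdeal I ∧ I ≠ ⊤}
    (fun c hc hchain y hy => by
      have hdir : DirectedOn (· ≤ ·) c := hchain.directedOn
      refine ⟨sSup c, ⟨fun a b h hb => ?_, fun htop => ?_⟩, fun z hz => le_sSup hz⟩
      · rw [Submodule.mem_sSup_of_directed ⟨y, hy⟩ hdir] at hb ⊢
        obtain ⟨J, hJ, hb⟩ := hb
        exact ⟨J, hJ, (hc hJ).1 a b h hb⟩
      · rw [Ideal.eq_top_iff_one, Submodule.mem_sSup_of_directed ⟨y, hy⟩ hdir] at htop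
        obtain ⟨J, hJ, h1⟩ := htop
        exact (hc hJ).2 ((Ideal.eq_top_iff_one J).mpr h1)) I ⟨hI, hI'⟩
  exact ⟨⟨M, hM⟩, hIM⟩

variable [Algebra ℝ A] [IsBal A]

/-- The `ℓ`-ideal generated by `a`. -/
def principal (a : A) : Ideal A where
  carrier := {b | ∃ k : ℕ, |b| ≤ k • |a|}
  zero_mem' := ⟨0, by simp⟩
  add_mem' := by
    rintro b c ⟨k, h⟩ ⟨k', h'⟩
    refine ⟨k + k', (abs_add_le b c).trans ?_⟩
    rw [add_nsmul]
    exact add_le_add h h'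
  smul_mem' := by
    rintro c b ⟨k, h⟩
    obtain ⟨n, hn⟩ := abs_le_nat c
    rw [cst_natCast] at hn
    refine ⟨n * k, ?_⟩
    calc |c * b| ≤ |c| * |b| := abs_mul_le_mul c b
      _ ≤ n * |b| := mul_le_mul_of_nonneg_right hn (abs_nonneg b)
      _ ≤ n * (k • |a|) := mul_le_mul_of_nonneg_left h n.cast_nonneg
      _ = _ := by rw [mul_nsmul', nsmul_eq_mul n]

lemma isLIdeal_principal (a : A) : IsLIdeal (principal a) :=
  fun _ _ h ⟨k, h'⟩ => ⟨k, h.trans h'⟩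

lemma self_mem_principal (a : A) : a ∈ principal a := ⟨1, by simp⟩

/-- This is where the archimedean axiom enters. If `n • a ≤ 1` failed, `(n • a - 1)⁻` would lie in
some maximal `ℓ`-ideal `x`, forcing `n * x.res a ≥ 1`. -/
lemma nonpos_of_res_nonpos {a : A} (h : ∀ x : LSpec A, x.res a ≤ 0) : a ≤ 0 := by
  refine IsBal.arch a 1 fun n => ?_
  by_contra hn
  have hproper : principal (n • a - 1)⁻ ≠ ⊤ := by
    intro htop
    obtain ⟨k, hk⟩ := (Ideal.eq_top_iff_one _).mp htop
    rw [abs_of_nonneg (negPart_nonneg _), abs_of_nonneg zero_le_one] at hk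
    -- Multiplying `1 ≤ k • (n • a - 1)⁻` by the positive part kills the right-hand side, since the
    -- two parts have product zero.
    have h1 := mul_le_mul_of_nonneg_left hk (posPart_nonneg (n • a - 1))
    rw [mul_one, mul_smul_comm, posPart_mul_negPart, smul_zero] at h1
    exact hn (sub_nonpos.mp ((le_posPart _).trans h1))
  obtain ⟨x, hx⟩ := exists_le_of_isLIdeal (isLIdeal_principal _) hproper
  have h0 : x.res (n • a - 1)⁻ = 0 := res_eq_zero.mpr (hx (self_mem_principal _))
  have h1 : x.res (n • a - 1) = x.res (n • a - 1)⁺ := by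
    conv_lhs => rw [← posPart_sub_negPart (n • a - 1)]
    rw [res_sub, h0, sub_zero]
  have h2 := x.res_nonneg (posPart_nonneg (n • a - 1))
  have h3 : x.res (n • a) = n * x.res a := by
    rw [nsmul_eq_mul, res_mul, ← cst_natCast, res_cst]
  have h4 : x.res 1 = 1 := by simpa [cst] using x.res_cst 1
  rw [← h1, res_sub, h3, h4] at h2
  have := mul_nonpos_of_nonneg_of_nonpos n.cast_nonneg (h x)
  linarith

lemma le_iff_res_le {a b : A} : a ≤ b ↔ ∀ x : LSpec A, x.res a ≤ x.res b := by
  refine ⟨fun h x => x.res_mono h, fun h => sub_nonpos.mp (nonpos_of_res_nonpos fun x => ?_)⟩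
  rw [res_sub]
  linarith [h x]

lemma eq_iff_res_eq {a b : A} : a = b ↔ ∀ x : LSpec A, x.res a = x.res b :=
  ⟨fun h _ => h ▸ rfl, fun h => le_antisymm (le_iff_res_le.mpr fun x => (h x).le)
    (le_iff_res_le.mpr fun x => (h x).ge)⟩

lemma abs_le_cst_iff {a : A} {r : ℝ} : |a| ≤ cst A r ↔ ∀ x : LSpec A, |x.res a| ≤ r := by
  simp only [le_iff_res_le, res_abs, res_cst]

lemma res_sup (x : LSpec A) (a b : A) : x.res (a ⊔ b) = x.res a ⊔ x.res b := by
  have h : a ⊔ b = (a - b)⁺ + b := by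
    rw [posPart_def, sup_add, sub_add_cancel, zero_add]
  rw [h, res_add, res_posPart, res_sub, max_def, max_def]
  split_ifs <;> linarith

lemma res_inf (x : LSpec A) (a b : A) : x.res (a ⊓ b) = x.res a ⊓ x.res b := by
  have h := res_add x (a ⊓ b) (a ⊔ b)
  rw [inf_add_sup, res_add, res_sup] at h
  have := min_add_max (x.res a) (x.res b)
  linarith

lemma continuous_res (a : A) : Continuous fun x : LSpec A => x.res a :=
  continuous_iff_lower_upperSemicontinuous.mpr
    ⟨lowerSemicontinuous_iff_isClosed_preimage.mpr fun r => isClosed_res_le a r,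
      upperSemicontinuous_iff_isClosed_preimage.mpr fun r => isClosed_le_res a r⟩

end LSpec

/-! ### Monotone continuous functions on Nachbin spaces -/

section Nachbin

variable {X : Type*} [TopologicalSpace X] [CompactSpace X] [PartialOrder X]
  [OrderClosedTopology X]

/-- The down-closure is the projection of a closed, hence compact, part of the graph of the order.
-/
lemma isClosed_lowerClosure {s : Set X} (hs : IsClosed s) : IsClosed (lowerClosure s : Set X) := by
  have h : (lowerClosure s : Set X) = Prod.fst '' ({p : X × X | p.1 ≤ p.2} ∩ Prod.snd ⁻¹' s) := by
    ext x
    simp only [SetLike.mem_coe, mem_lowerClosure, Set.mem_image, Set.mem_inter_iff,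
      Set.mem_ofPred_eq, Set.mem_preimage, Prod.exists, exists_and_right, exists_eq_right]
    exact ⟨fun ⟨y, hy, hxy⟩ => ⟨y, hxy, hy⟩, fun ⟨y, hxy, hy⟩ => ⟨y, hy, hxy⟩⟩
  rw [h]
  exact ((OrderClosedTopology.isClosed_le'.inter (hs.preimage continuous_snd)).isCompact.image
    continuous_fst).isClosed

lemma isClosed_upperClosure {s : Set X} (hs : IsClosed s) : IsClosed (upperClosure s : Set X) := by
  have h : (upperClosure s : Set X) = Prod.snd '' ({p : X × X | p.1 ≤ p.2} ∩ Prod.fst ⁻¹' s) := by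
    ext x
    simp only [SetLike.mem_coe, mem_upperClosure, Set.mem_image, Set.mem_inter_iff,
      Set.mem_ofPred_eq, Set.mem_preimage, Prod.exists, exists_eq_right]
    exact ⟨fun ⟨y, hy, hxy⟩ => ⟨y, hxy, hy⟩, fun ⟨y, hxy, hy⟩ => ⟨y, hy, hxy⟩⟩
  rw [h]
  exact ((OrderClosedTopology.isClosed_le'.inter (hs.preimage continuous_fst)).isCompact.image
    continuous_snd).isClosed

/-- Nachbin spaces are monotonically normal. -/
lemma exists_isOpen_isLowerSet_between {c u : Set X} (hc : IsClosed c) (hu : IsOpen u)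
    (hl : IsLowerSet u) (hcu : c ⊆ u) :
    ∃ v, IsOpen v ∧ IsLowerSet v ∧ c ⊆ v ∧ closure v ⊆ u := by
  obtain ⟨w, hw, hcw, hwu⟩ := normal_exists_closure_subset (isClosed_lowerClosure hc) hu
    (fun x ⟨y, hy, hxy⟩ => hl hxy (hcu hy))
  -- This is the largest lower set inside `w`. It contains `c` because `w` contains the whole
  -- down-closure of `c`.
  refine ⟨(upperClosure wᶜ : Set X)ᶜ, (isClosed_upperClosure hw.isClosed_compl).isOpen_compl,
    (upperClosure wᶜ).upper.compl, fun x hx ⟨y, hy, hyx⟩ => hy (hcw ⟨x, hx, hyx⟩), ?_⟩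
  refine (closure_mono ?_).trans hwu
  exact Set.compl_subset_comm.mp subset_upperClosure

-- The initial approximation is the indicator of the complement of a lower set, and each later one
-- is a midpoint of two earlier ones, so monotonicity propagates.
omit [CompactSpace X] [OrderClosedTopology X] in
lemma _root_.Urysohns.CU.monotone_approx {P : Set X → Set X → Prop}
    (hP : ∀ c u, P c u → IsLowerSet u) (n : ℕ) (c : Urysohns.CU P) : Monotone (c.approx n) := by
  induction n generalizing c with
  | zero =>
    intro x y h
    by_cases hy : y ∈ c.U
    · rw [Urysohns.CU.approx, Urysohns.CU.approx,
        Set.indicator_of_notMem (Set.notMem_compl_iff.mpr (hP _ _ c.P_C_U h hy)),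
        Set.indicator_of_notMem (Set.notMem_compl_iff.mpr hy)]
    · rw [c.approx_of_notMem_U 0 hy]
      exact c.approx_le_one 0 x
  | succ n ih => exact fun x y h => midpoint_le_midpoint (ih c.left h) (ih c.right h)

omit [CompactSpace X] [OrderClosedTopology X] in
lemma _root_.Urysohns.CU.monotone_lim {P : Set X → Set X → Prop}
    (hP : ∀ c u, P c u → IsLowerSet u) (c : Urysohns.CU P) : Monotone c.lim := fun _ _ h =>
  le_of_tendsto_of_tendsto' (c.tendsto_approx_atTop _) (c.tendsto_approx_atTop _)
    fun n => c.monotone_approx hP n h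

/-- Nachbin's separation theorem. -/
lemma exists_monotone_separating {x y : X} (h : ¬ x ≤ y) :
    ∃ f : C(X, ℝ), Monotone f ∧ f y < f x := by
  -- Urysohn's construction run with lower open sets only, from `{y}` to the complement of the
  -- up-set of `x`; the limit is `0` at `y` and `1` at `x`.
  let c : Urysohns.CU (fun _ u : Set X => IsLowerSet u) :=
    { C := {y}
      U := (Set.Ici x)ᶜ
      P_C_U := (isUpperSet_Ici x).compl
      closed_C := isClosed_singleton
      open_U := isClosed_Ici.isOpen_compl
      subset := by simpa using h
      hP := fun hc hl hu hcu => by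
        obtain ⟨v, h1, h2, h3, h4⟩ := exists_isOpen_isLowerSet_between hc hu hl hcu
        exact ⟨v, h1, h3, h4, h2, hl⟩ }
  refine ⟨⟨c.lim, c.continuous_lim⟩, c.monotone_lim (fun _ _ h => h), ?_⟩
  have h1 : c.lim y = 0 := c.lim_of_mem_C y rfl
  have h2 : c.lim x = 1 := c.lim_of_notMem_U x (by simp [c])
  simp [h1, h2]

lemma le_iff_forall_monotone {x y : X} :
    x ≤ y ↔ ∀ f ∈ (monotoneFunctions X).carrier, f x ≤ f y := by
  refine ⟨fun h f hf => hf h, fun h => ?_⟩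
  by_contra hxy
  obtain ⟨f, hf, hlt⟩ := exists_monotone_separating hxy
  exact absurd (h f hf) (not_le.mpr hlt)

/-! ### Approximation and insertion by order-preserving functions -/

omit [OrderClosedTopology X]

omit [CompactSpace X] [PartialOrder X] in
lemma cst_apply (r : ℝ) (x : X) : cst C(X, ℝ) r x = r := by
  simp [cst]

/-- An `sbal`-subalgebra of `C(X)` determining the order approximately interpolates between
functions compatible with the order. -/
lemma SbalSub.exists_near_between (S : SbalSub C(X, ℝ))
    (hS : ∀ x y : X, (∀ s ∈ S.carrier, s x ≤ s y) → x ≤ y) {f g : C(X, ℝ)}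
    (h : ∀ x y, x ≤ y → f x ≤ g y) {ε : ℝ} (hε : 0 < ε) :
    ∃ s ∈ S.carrier, ∀ x, f x - ε ≤ s x ∧ s x ≤ g x + ε := by
  rcases isEmpty_or_nonempty X with hX | hX
  · exact ⟨_, S.cst_mem 0, fun x => isEmptyElim x⟩
  -- Two-point interpolation. If `x ≤ y`, the constant `f x` works; otherwise some `s ∈ S` has `s y
  -- < s x`, the right direction for rescaling by a nonnegative factor, the only kind `S` allows.
  have key : ∀ x y : X, ∃ s ∈ S.carrier, f x ≤ s x ∧ s y ≤ g y := by
    intro x y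
    by_cases hxy : x ≤ y
    · exact ⟨_, S.cst_mem (f x), le_rfl, h x y hxy⟩
    · obtain ⟨s, hs, hlt⟩ : ∃ s ∈ S.carrier, s y < s x := by
        by_contra! hcon
        exact hxy (hS x y hcon)
      -- With this slope the shifted function equals `g y` at `y` and `g y + |f x - g y| ≥ f x` at
      -- `x`.
      let k : ℝ := |f x - g y| / (s x - s y)
      have hk : 0 ≤ k := div_nonneg (abs_nonneg _) (by linarith)
      refine ⟨_, S.add_mem (S.smul_mem hk hs) (S.cst_mem (g y - k * s y)), ?_, ?_⟩
      · have h1 : k * (s x - s y) = |f x - g y| := div_mul_cancel₀ _ (by linarith)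
        have h2 := le_abs_self (f x - g y)
        rw [ContinuousMap.add_apply, cst_apply, ContinuousMap.smul_apply, smul_eq_mul]
        linarith
      · rw [ContinuousMap.add_apply, cst_apply, ContinuousMap.smul_apply, smul_eq_mul]
        linarith
  choose s hs hs1 hs2 using key
  have hnhds : ∀ y x : X, {z | f z - ε < s x y z} ∈ nhds x := fun y x =>
    (isOpen_lt (by fun_prop) (by fun_prop)).mem_nhds (by
      have := hs1 x y
      change f x - ε < s x y x
      linarith)
  choose t ht using fun y => CompactSpace.elim_nhds_subcover _ (hnhds y)
  have htne : ∀ y, (t y).Nonempty := fun y =>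
    Set.nonempty_of_union_eq_top_of_nonempty _ _ hX (ht y)
  -- As in Stone–Weierstrass: for fixed `y` a finite join stays above `f - ε` everywhere while
  -- remaining below `g` at `y`; a finite meet over `y` then brings it below `g + ε`.
  let p : X → C(X, ℝ) := fun y => (t y).sup' (htne y) fun x => s x y
  have hpS : ∀ y, p y ∈ S.carrier := fun y =>
    Finset.sup'_mem _ (fun _ ha _ hb => S.sup_mem ha hb) _ _ _ fun x _ => hs x y
  have hp1 : ∀ y z, f z - ε ≤ p y z := by
    intro y z
    obtain ⟨x, hx, hz⟩ := Set.exists_set_mem_of_union_eq_top _ _ (ht y) z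
    have h1 : s x y ≤ p y := Finset.le_sup' (fun x => s x y) hx
    exact (le_of_lt hz).trans (h1 z)
  have hp2 : ∀ y, p y y ≤ g y := by
    intro y
    simp only [p, ContinuousMap.sup'_apply, Finset.sup'_le_iff]
    exact fun x _ => hs2 x y
  have hnhds' : ∀ y : X, {z | p y z < g z + ε} ∈ nhds y := fun y =>
    (isOpen_lt (by fun_prop) (by fun_prop)).mem_nhds (by
      have := hp2 y
      change p y y < g y + ε
      linarith)
  obtain ⟨r, hr⟩ := CompactSpace.elim_nhds_subcover _ hnhds'
  have hrne : r.Nonempty := Set.nonempty_of_union_eq_top_of_nonempty _ _ hX hr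
  refine ⟨r.inf' hrne p, Finset.inf'_mem _ (fun _ ha _ hb => S.inf_mem ha hb) _ _ _
    fun y _ => hpS y, fun z => ⟨?_, ?_⟩⟩
  · simp only [ContinuousMap.inf'_apply, Finset.le_inf'_iff]
    exact fun y _ => hp1 y z
  · obtain ⟨y, hy, hz⟩ := Set.exists_set_mem_of_union_eq_top _ _ hr z
    have h1 : r.inf' hrne p ≤ p y := Finset.inf'_le p hy
    exact (h1 z).trans (le_of_lt hz)

/-- The ordered Stone–Weierstrass theorem. -/
lemma SbalSub.exists_near_monotone (S : SbalSub C(X, ℝ))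
    (hS : ∀ x y : X, (∀ s ∈ S.carrier, s x ≤ s y) → x ≤ y) {f : C(X, ℝ)} (hf : Monotone f)
    {ε : ℝ} (hε : 0 < ε) : ∃ s ∈ S.carrier, ∀ x, |f x - s x| ≤ ε := by
  obtain ⟨s, hs, h⟩ := S.exists_near_between hS (f := f) (g := f) (fun x y h => hf h) hε
  refine ⟨s, hs, fun x => abs_le.mpr ⟨?_, ?_⟩⟩ <;> linarith [h x]

omit [PartialOrder X] in
lemma exists_limit_of_cauchy {u : ℕ → C(X, ℝ)}
    (h : ∀ ε : ℝ, 0 < ε → ∃ N, ∀ m ≥ N, ∀ n ≥ N, ∀ x, |u m x - u n x| ≤ ε) :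
    ∃ f : C(X, ℝ), ∀ ε : ℝ, 0 < ε → ∃ N, ∀ n ≥ N, ∀ x, |u n x - f x| ≤ ε := by
  have hc : CauchySeq u := Metric.cauchySeq_iff.mpr fun ε hε => by
    obtain ⟨N, hN⟩ := h (ε / 2) (half_pos hε)
    refine ⟨N, fun m hm n hn => lt_of_le_of_lt ?_ (half_lt_self hε)⟩
    exact (ContinuousMap.dist_le (half_pos hε).le).mpr fun x => by
      rw [Real.dist_eq]; exact hN m hm n hn x
  obtain ⟨f, hf⟩ := cauchySeq_tendsto_of_complete hc
  refine ⟨f, fun ε hε => ?_⟩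
  obtain ⟨N, hN⟩ := Metric.tendsto_atTop.mp hf ε hε
  refine ⟨N, fun n hn x => ?_⟩
  rw [← Real.dist_eq]
  exact (ContinuousMap.dist_apply_le_dist x).trans (hN n hn).le

omit [CompactSpace X] in
lemma monotone_of_limit {u : ℕ → C(X, ℝ)} (hu : ∀ n, Monotone (u n)) {f : C(X, ℝ)}
    (h : ∀ ε : ℝ, 0 < ε → ∃ N, ∀ n ≥ N, ∀ x, |u n x - f x| ≤ ε) : Monotone f := by
  intro x y hxy
  refine le_of_forall_pos_le_add fun ε hε => ?_
  obtain ⟨N, hN⟩ := h (ε / 2) (half_pos hε)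
  have h1 := abs_le.mp (hN N le_rfl x)
  have h2 := abs_le.mp (hN N le_rfl y)
  have h3 := hu N hxy
  linarith [h1.1, h2.2]

variable [OrderClosedTopology X]

/-- Nachbin's insertion theorem. -/
lemma monotoneFunctions_prec_iff {f g : C(X, ℝ)} :
    (monotoneFunctions X).prec f g ↔ ∀ x y, x ≤ y → f x ≤ g y := by
  refine ⟨fun ⟨c, hc, h1, h2⟩ x y h => (h1 x).trans ((hc h).trans (h2 y)), fun h => ?_⟩
  have hS : ∀ x y : X, (∀ s ∈ (monotoneFunctions X).carrier, s x ≤ s y) → x ≤ y :=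
    fun x y => le_iff_forall_monotone.mpr
  -- Approximate interpolants with error `2⁻ⁿ`, corrected successively so that they form a Cauchy
  -- sequence whose limit interpolates exactly.
  let Q : ℕ → C(X, ℝ) → Prop := fun n c =>
    Monotone c ∧ ∀ x, f x - (1 / 2) ^ n ≤ c x ∧ c x ≤ g x + (1 / 2) ^ n
  have step : ∀ n c, Q n c → ∃ d, Q (n + 1) d ∧ ∀ x, |d x - c x| ≤ 2 * (1 / 2) ^ n := by
    rintro n c ⟨hc, hb⟩
    have hpos : (0 : ℝ) < (1 / 2) ^ (n + 1) := by positivity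
    have hlt : (1 / 2 : ℝ) ^ (n + 1) = (1 / 2) ^ n / 2 := by rw [pow_succ]; ring
    -- Truncating `f` and `g` to the band of width `2⁻ⁿ` around `c` keeps the new interpolant close
    -- to `c`; the truncated pair is still compatible with the order because `c` is monotone and
    -- nearly between `f` and `g`.
    obtain ⟨d, hd, hdb⟩ := (monotoneFunctions X).exists_near_between hS
      (f := f ⊔ (c - ContinuousMap.const X ((1 / 2) ^ n)))
      (g := g ⊓ (c + ContinuousMap.const X ((1 / 2) ^ n))) (fun x y hxy => by
        have h1 := h x y hxy
        have h2 : c x ≤ c y := hc hxy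
        have h3 := (hb x).1
        have h4 := (hb y).2
        have h5 : (0 : ℝ) < (1 / 2) ^ n := by positivity
        change max (f x) (c x - (1 / 2) ^ n) ≤ min (g y) (c y + (1 / 2) ^ n)
        refine max_le (le_min h1 ?_) (le_min ?_ ?_) <;> linarith) hpos
    have hd1 : ∀ x, max (f x) (c x - (1 / 2) ^ n) - (1 / 2) ^ (n + 1) ≤ d x := fun x => (hdb x).1
    have hd2 : ∀ x, d x ≤ min (g x) (c x + (1 / 2) ^ n) + (1 / 2) ^ (n + 1) := fun x => (hdb x).2
    refine ⟨d, ⟨hd, fun x => ⟨?_, ?_⟩⟩, fun x => abs_le.mpr ⟨?_, ?_⟩⟩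
    · linarith [hd1 x, le_max_left (f x) (c x - (1 / 2) ^ n)]
    · linarith [hd2 x, min_le_left (g x) (c x + (1 / 2) ^ n)]
    · linarith [hd1 x, le_max_right (f x) (c x - (1 / 2) ^ n)]
    · linarith [hd2 x, min_le_right (g x) (c x + (1 / 2) ^ n)]
  obtain ⟨c₀, hc₀, hb₀⟩ := (monotoneFunctions X).exists_near_between hS h one_pos
  choose! next hnext hclose using step
  let u : ℕ → C(X, ℝ) := fun n => Nat.rec c₀ (fun n c => next n c) n
  have hQ : ∀ n, Q n (u n) := by
    intro n
    induction n with
    | zero => exact ⟨hc₀, fun x => by rw [pow_zero]; exact hb₀ x⟩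
    | succ n ih => exact hnext n _ ih
  have hcau : CauchySeq u := cauchySeq_of_le_geometric (1 / 2) 2 (by norm_num) fun n =>
    (ContinuousMap.dist_le (by positivity)).mpr fun x => by
      rw [dist_comm, Real.dist_eq]
      exact hclose n _ (hQ n) x
  obtain ⟨c, hc⟩ := cauchySeq_tendsto_of_complete hcau
  have hlim : ∀ x, Filter.Tendsto (fun n => u n x) Filter.atTop (nhds (c x)) := fun x =>
    ((continuous_eval_const x).tendsto c).comp hc
  have hpow : Filter.Tendsto (fun n : ℕ => (1 / 2 : ℝ) ^ n) Filter.atTop (nhds 0) :=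
    tendsto_pow_atTop_nhds_zero_of_lt_one (by norm_num) (by norm_num)
  refine ⟨c, fun x y hxy => le_of_tendsto_of_tendsto' (hlim x) (hlim y) fun n => (hQ n).1 hxy,
    fun x => ?_, fun x => ?_⟩
  · have h1 := hpow.const_sub (f x)
    rw [sub_zero] at h1
    exact le_of_tendsto_of_tendsto' h1 (hlim x) fun n => ((hQ n).2 x).1
  · have h1 := hpow.const_add (g x)
    rw [add_zero] at h1
    exact le_of_tendsto_of_tendsto' (hlim x) h1 fun n => ((hQ n).2 x).2

end Nachbin

/-! ### The values of the functors -/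

@[ext]
lemma SbalSub.ext {A : Type*} [CommRing A] [Lattice A] [Algebra ℝ A] {S T : SbalSub A}
    (h : S.carrier = T.carrier) : S = T := by
  cases S
  cases T
  cases h
  rfl

section Envelope

variable {A : Type u} [CommRing A] [Lattice A] [Algebra ℝ A] [IsBal A]

/-- Only `x` itself lies between `x` and `x`, so the proximity induced by `S` remembers `S`. -/
lemma SbalSub.skeleton_prec (S : SbalSub A) :
    S.prec_isReflexiveProximity.toIsProximity.skeleton = S :=
  SbalSub.ext (Set.ext fun x => ⟨fun ⟨_, hs, h1, h2⟩ => le_antisymm h1 h2 ▸ hs,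
    fun hx => ⟨x, hx, le_rfl, le_rfl⟩⟩)

lemma skel_envelope (S : SbalSub A) : (envelope S).skel = S.inEnv := S.inEnv.skeleton_prec

lemma spbal_envelope (S : SbalSub A) : spbal (envelope S) := by
  change (envelope S).skel.env = ⊤
  rw [skel_envelope, eq_top_iff]
  rintro ⟨_, a, ha, b, hb, rfl⟩ -
  exact ⟨⟨a, S.le_env ha⟩, ha, ⟨b, S.le_env hb⟩, hb, rfl⟩

lemma uspbal_envelope {S : SbalSub A} (h : UniformlyComplete S.carrier) :
    uspbal (envelope S) := by
  refine ⟨spbal_envelope S, ?_⟩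
  rw [skel_envelope]
  refine uniformlyComplete_iff.mpr fun u hu hc => ?_
  obtain ⟨a, ha, hlim⟩ := uniformlyComplete_iff.mp h (fun n => (u n).1) hu hc
  exact ⟨⟨a, S.le_env ha⟩, ha, hlim⟩

end Envelope

lemma spbal_le_nbal : spbal.{u} ≤ nbal.{u} := by
  intro A (hA : A.skel.env = ⊤)
  refine uniformlyDense_iff.mpr fun a ε hε => ⟨a, ?_, ?_⟩
  · rw [hA]
    trivial
  · rw [sub_self, abs_zero]
    exact cst_nonneg hε.le

/-! ### Completeness, density and closedness in `C(X)` -/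

section ContinuousFunctions

variable {X : Type*} [TopologicalSpace X]

lemma abs_le_cst_iff_forall {f : C(X, ℝ)} {r : ℝ} : |f| ≤ cst C(X, ℝ) r ↔ ∀ x, |f x| ≤ r := by
  rw [ContinuousMap.le_def]
  refine forall_congr' fun x => ?_
  rw [cst_apply, ContinuousMap.abs_apply]

variable [CompactSpace X]

lemma uniformlyComplete_univ : UniformlyComplete (Set.univ : Set C(X, ℝ)) := by
  refine uniformlyComplete_iff.mpr fun u _ hc => ?_
  simp only [abs_le_cst_iff_forall] at hc ⊢
  obtain ⟨f, hf⟩ := exists_limit_of_cauchy hc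
  exact ⟨f, trivial, hf⟩

variable [PartialOrder X]

lemma uniformlyComplete_monotoneFunctions :
    UniformlyComplete (monotoneFunctions X).carrier := by
  refine uniformlyComplete_iff.mpr fun u hu hc => ?_
  simp only [abs_le_cst_iff_forall] at hc ⊢
  obtain ⟨f, hf⟩ := exists_limit_of_cauchy hc
  exact ⟨f, monotone_of_limit hu hf, hf⟩

variable [OrderClosedTopology X]

/-- Classical Stone–Weierstrass: by antisymmetry, distinct points fail to be comparable in at least
one direction, so an order-preserving function separates them. -/
lemma uniformlyDense_monotoneFunctions_env :
    UniformlyDense ((monotoneFunctions X).env : Set C(X, ℝ)) := by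
  refine uniformlyDense_iff.mpr fun f ε hε => ?_
  have hsep : (monotoneFunctions X).env.SeparatesPoints := by
    intro x y hxy
    have hor : ¬ x ≤ y ∨ ¬ y ≤ x := by
      by_contra! h
      exact hxy (le_antisymm h.1 h.2)
    rcases hor with h | h <;> obtain ⟨g, hg, hlt⟩ := exists_monotone_separating h
    · exact ⟨g, ⟨g, SbalSub.le_env _ hg, rfl⟩, hlt.ne'⟩
    · exact ⟨g, ⟨g, SbalSub.le_env _ hg, rfl⟩, hlt.ne⟩
  obtain ⟨g, hg⟩ := ContinuousMap.exists_mem_subalgebra_near_continuousMap_of_separatesPoints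
    _ hsep f ε hε
  refine ⟨g, g.2, abs_le_cst_iff_forall.mpr fun x => ?_⟩
  rw [ContinuousMap.sub_apply, abs_sub_comm]
  exact (((g : C(X, ℝ)) - f).norm_coe_le_norm x).trans hg.le

/-- By the insertion theorem the relation is a family of pointwise inequalities, and these survive
uniform limits; the interpolants themselves need not converge. -/
lemma closedRel_monotoneFunctions : ClosedRel (monotoneFunctions X).prec := by
  refine closedRel_iff.mpr fun f g h => monotoneFunctions_prec_iff.mpr fun x y hxy => ?_
  refine le_of_forall_pos_le_add fun ε hε => ?_
  obtain ⟨f', g', hp, h1, h2⟩ := h (ε / 2) (half_pos hε)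
  have h3 := abs_le.mp (abs_le_cst_iff_forall.mp h1 x)
  have h4 := abs_le.mp (abs_le_cst_iff_forall.mp h2 y)
  have h5 := monotoneFunctions_prec_iff.mp hp x y hxy
  rw [ContinuousMap.sub_apply] at h3 h4
  linarith

end ContinuousFunctions

lemma uspbal_functorBC (X : Nach.{u}ᵒᵖ) : uspbal (functorBC.obj X) :=
  uspbal_envelope uniformlyComplete_monotoneFunctions

lemma unbal_functorC (X : Nach.{u}ᵒᵖ) : unbal (functorC.obj X) := by
  refine ⟨?_, uniformlyComplete_univ, closedRel_monotoneFunctions⟩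
  change UniformlyDense ((monotoneFunctions X.unop.carrier).prec_isReflexiveProximity.toIsProximity
    |>.skeleton.env : Set C(X.unop.carrier, ℝ))
  rw [SbalSub.skeleton_prec]
  exact uniformlyDense_monotoneFunctions_env

lemma uspbal_functorBR (A : Pbal.{u}) (hA : unbal A) : uspbal (functorBR.obj A) := by
  obtain ⟨-, hcomp, hclosed⟩ := hA
  refine uspbal_envelope (uniformlyComplete_iff.mpr fun u hu hc => ?_)
  obtain ⟨a, -, hlim⟩ := uniformlyComplete_iff.mp hcomp u (fun _ => trivial) hc
  -- The limit exists in `A`; closedness of `≺` at the diagonal pair `(a, a)` makes it reflexive.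
  refine ⟨a, closedRel_iff.mp hclosed a a fun ε hε => ?_, hlim⟩
  obtain ⟨N, hN⟩ := hlim ε hε
  have h := hN N le_rfl
  rw [abs_sub_comm] at h
  exact ⟨u N, u N, hu N, h, h⟩

/-! ### The representation of `A` by functions on its spectrum -/

section Representation

variable {A : Type*} [CommRing A] [Lattice A] [Algebra ℝ A] [IsBal A]

/-- The image of an `sbal`-subalgebra under a unital `ℓ`-algebra homomorphism. -/
def SbalSub.map {B : Type*} [CommRing B] [Lattice B] [Algebra ℝ B] (α : BalHom A B)
    (S : SbalSub A) : SbalSub B where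
  carrier := α.toAlgHom '' S.carrier
  cst_mem := fun r => ⟨_, S.cst_mem r, α.toAlgHom.commutes r⟩
  add_mem := by
    rintro _ _ ⟨a, ha, rfl⟩ ⟨b, hb, rfl⟩
    exact ⟨_, S.add_mem ha hb, map_add _ a b⟩
  sup_mem := by
    rintro _ _ ⟨a, ha, rfl⟩ ⟨b, hb, rfl⟩
    exact ⟨_, S.sup_mem ha hb, α.map_sup' a b⟩
  inf_mem := by
    rintro _ _ ⟨a, ha, rfl⟩ ⟨b, hb, rfl⟩
    exact ⟨_, S.inf_mem ha hb, α.map_inf' a b⟩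
  mul_mem := by
    rintro _ _ h0 h0' ⟨a, ha, rfl⟩ ⟨b, hb, rfl⟩
    -- A preimage of a nonnegative element may fail to be nonnegative, but its join with `0` has the
    -- same image.
    have key : ∀ c, 0 ≤ α.toAlgHom c → α.toAlgHom (c ⊔ 0) = α.toAlgHom c := fun c hc =>
      (α.map_sup' c 0).trans (sup_eq_left.mpr ((map_zero α.toAlgHom).trans_le hc))
    have h00 : (0 : A) ∈ S.carrier := cst_zero (A := A) ▸ S.cst_mem 0
    exact ⟨_, S.mul_mem le_sup_right le_sup_right (S.sup_mem ha h00) (S.sup_mem hb h00), by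
      rw [map_mul, key a h0, key b h0']⟩

namespace LSpec

variable (A) in
/-- The Gelfand representation `A → C(X_A)`, `a ↦ (x ↦ a + x ∈ A/x = ℝ)`. -/
noncomputable def gelfand : BalHom A C(LSpec A, ℝ) where
  toFun a := ⟨fun x => x.res a, continuous_res a⟩
  map_one' := ContinuousMap.ext fun x => by simpa [cst] using x.res_cst 1
  map_mul' a b := ContinuousMap.ext fun x => x.res_mul a b
  map_zero' := ContinuousMap.ext fun x => by simpa [cst] using x.res_cst 0
  map_add' a b := ContinuousMap.ext fun x => x.res_add a b
  commutes' r := ContinuousMap.ext fun x => x.res_cst r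
  map_sup' a b := ContinuousMap.ext fun x => x.res_sup a b
  map_inf' a b := ContinuousMap.ext fun x => x.res_inf a b

lemma gelfand_apply (a : A) (x : LSpec A) : (gelfand A).toAlgHom a x = x.res a := rfl

lemma gelfand_le_iff {a b : A} : (gelfand A).toAlgHom a ≤ (gelfand A).toAlgHom b ↔ a ≤ b :=
  le_iff_res_le.symm

/-- A uniformly complete set of elements of `A` has a uniformly closed image in `C(X_A)`. -/
lemma exists_gelfand_eq {s : Set A} (hs : UniformlyComplete s) {f : C(LSpec A, ℝ)}
    (h : ∀ ε : ℝ, 0 < ε → ∃ a ∈ s, ∀ x, |f x - x.res a| ≤ ε) :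
    ∃ a ∈ s, (gelfand A).toAlgHom a = f := by
  have hpos : ∀ n : ℕ, (0 : ℝ) < 1 / (n + 1) := fun n => Nat.one_div_pos_of_nat
  choose u hu hb using fun n : ℕ => h _ (hpos n)
  have hsmall : ∀ ε : ℝ, 0 < ε → ∃ N, ∀ n ≥ N, ∀ x, |f x - x.res (u n)| ≤ ε := by
    intro ε hε
    obtain ⟨N, hN⟩ := exists_nat_one_div_lt hε
    exact ⟨N, fun n hn x => (hb n x).trans ((Nat.one_div_le_one_div hn).trans hN.le)⟩
  obtain ⟨a, ha, hlim⟩ := uniformlyComplete_iff.mp hs u hu fun ε hε => by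
    obtain ⟨N, hN⟩ := hsmall (ε / 2) (half_pos hε)
    refine ⟨N, fun m hm n hn => abs_le_cst_iff.mpr fun x => ?_⟩
    have h1 := abs_le.mp (hN m hm x)
    have h2 := abs_le.mp (hN n hn x)
    rw [res_sub, abs_le]
    constructor <;> linarith
  refine ⟨a, ha, ContinuousMap.ext fun x => eq_of_forall_dist_le fun ε hε => ?_⟩
  obtain ⟨N, hN⟩ := hsmall (ε / 2) (half_pos hε)
  obtain ⟨M, hM⟩ := hlim (ε / 2) (half_pos hε)
  have h1 := abs_le.mp (hN (max N M) (le_max_left _ _) x)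
  have h2 := abs_le.mp (abs_le_cst_iff.mp (hM (max N M) (le_max_right _ _)) x)
  rw [res_sub] at h2
  rw [gelfand_apply, Real.dist_eq, abs_le]
  constructor <;> linarith

end LSpec

end Representation

namespace Pbal

variable (A : Pbal.{u}) (hA : nbal A)

lemma gelfand_mem_monotoneFunctions {c : A.carrier} (hc : c ∈ A.skel.carrier) :
    (LSpec.gelfand A.carrier).toAlgHom c ∈ (monotoneFunctions (A.spec hA).carrier).carrier :=
  fun _ _ h => down_subset_iff.mp h c hc

/-- The representation `A → 𝓒𝓧(A)`. -/
noncomputable def toC : A ⟶ functorC.obj (Opposite.op (A.spec hA)) where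
  hom := LSpec.gelfand A.carrier
  map_prec := fun a b h => by
    obtain ⟨c, hc, h1, h2⟩ := A.isReflexiveProximity.reflexive a b h
    exact ⟨_, A.gelfand_mem_monotoneFunctions hA hc,
      LSpec.gelfand_le_iff.mpr (A.isReflexiveProximity.le_of_prec _ _ h1),
      LSpec.gelfand_le_iff.mpr (A.isReflexiveProximity.le_of_prec _ _ h2)⟩

variable {A}

-- The image of the skeleton determines the order of the spectrum, by the very definition of that
-- order, so ordered Stone–Weierstrass applies to it.
include hA in
lemma exists_skel_near {f : C(LSpec A.carrier, ℝ)}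
    (hf : f ∈ (monotoneFunctions (A.spec hA).carrier).carrier) {ε : ℝ} (hε : 0 < ε) :
    ∃ c ∈ A.skel.carrier, ∀ x : LSpec A.carrier, |f x - x.res c| ≤ ε := by
  let _ := A.specPartialOrder hA
  obtain ⟨_, ⟨c, hc, rfl⟩, h⟩ := (A.skel.map (LSpec.gelfand A.carrier)).exists_near_monotone
    (fun x y h => down_subset_iff.mpr fun c hc => h _ ⟨c, hc, rfl⟩) (f := f) hf hε
  exact ⟨c, hc, h⟩

include hA in
lemma exists_skel_eq (hcomp : UniformlyComplete A.skel.carrier) {f : C(LSpec A.carrier, ℝ)}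
    (hf : f ∈ (monotoneFunctions (A.spec hA).carrier).carrier) :
    ∃ c ∈ A.skel.carrier, (LSpec.gelfand A.carrier).toAlgHom c = f :=
  LSpec.exists_gelfand_eq hcomp fun _ hε => exists_skel_near hA hf hε

lemma hom_ext {A B : Pbal.{u}} {f g : A ⟶ B}
    (h : ∀ a, f.hom.toAlgHom a = g.hom.toAlgHom a) : f = g := by
  obtain ⟨⟨f, _, _⟩, _⟩ := f
  obtain ⟨⟨g, _, _⟩, _⟩ := g
  obtain rfl : f = g := AlgHom.ext h
  rfl

/-- Bijectivity alone would not suffice: the inverse preserves `≺` only because `f` reflects it. -/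
lemma isIso_of_bijective {A B : Pbal.{u}} (f : A ⟶ B) (hs : Function.Surjective f.hom.toAlgHom)
    (hle : ∀ a b, f.hom.toAlgHom a ≤ f.hom.toAlgHom b → a ≤ b)
    (hp : ∀ a b, B.prec (f.hom.toAlgHom a) (f.hom.toAlgHom b) → A.prec a b) : IsIso f := by
  have hi : Function.Injective f.hom.toAlgHom := fun a b h =>
    le_antisymm (hle _ _ h.le) (hle _ _ h.ge)
  let e : A.carrier ≃ₐ[ℝ] B.carrier := AlgEquiv.ofBijective f.hom.toAlgHom ⟨hi, hs⟩
  have he : ∀ b, f.hom.toAlgHom (e.symm b) = b := e.apply_symm_apply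
  let g : B ⟶ A :=
    { hom :=
        { e.symm.toAlgHom with
          map_sup' := fun a b => hi ((he _).trans
            ((congrArg₂ _ (he a) (he b)).symm.trans (f.hom.map_sup' _ _).symm))
          map_inf' := fun a b => hi ((he _).trans
            ((congrArg₂ _ (he a) (he b)).symm.trans (f.hom.map_inf' _ _).symm)) }
      map_prec := fun a b h => hp _ _ (by
        change B.prec (f.hom.toAlgHom (e.symm a)) (f.hom.toAlgHom (e.symm b))
        rwa [he, he]) }
  exact ⟨g, hom_ext e.symm_apply_apply, hom_ext he⟩

/-- Completeness of `A` gives surjectivity, since differences of skeleton elements are dense in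
`C(X_A)`; closedness of `≺` gives its reflection. -/
lemma isIso_toC (hA' : unbal A) : IsIso (A.toC hA) := by
  obtain ⟨-, hcomp, hclosed⟩ := hA'
  refine isIso_of_bijective _ (fun (f : C(LSpec A.carrier, ℝ)) => ?_)
    (fun a b => LSpec.gelfand_le_iff.mp) ?_
  · obtain ⟨a, -, ha⟩ := LSpec.exists_gelfand_eq hcomp (f := f) fun ε hε => by
      obtain ⟨_, ⟨(g : C(LSpec A.carrier, ℝ)), hg, (h : C(LSpec A.carrier, ℝ)), hh, rfl⟩, hb⟩ :=
        uniformlyDense_iff.mp (uniformlyDense_monotoneFunctions_env (X := (A.spec hA).carrier)) f (ε / 3) (by positivity)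
      obtain ⟨c, -, hc⟩ := exists_skel_near hA hg (show 0 < ε / 3 by positivity)
      obtain ⟨d, -, hd⟩ := exists_skel_near hA hh (show 0 < ε / 3 by positivity)
      refine ⟨c - d, trivial, fun x => ?_⟩
      have h0 : |f x - (g x - h x)| ≤ ε / 3 := abs_le_cst_iff_forall.mp hb x
      have h1 := abs_le.mp h0
      have h2 := abs_le.mp (hc x)
      have h3 := abs_le.mp (hd x)
      rw [LSpec.res_sub, abs_le]
      constructor <;> linarith
    exact ⟨a, ha⟩
  · rintro a b ⟨(g : C(LSpec A.carrier, ℝ)), hg, h1, h2⟩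
    refine closedRel_iff.mp hclosed a b fun ε hε => ?_
    obtain ⟨c, hc, hb⟩ := exists_skel_near hA hg hε
    -- The interpolant `g` need not come from `A`, but a reflexive `c` within `ε` of it lies between
    -- `a - ε` and `b + ε`.
    refine ⟨a - cst _ ε, b + cst _ ε, A.isReflexiveProximity.mono _ _ _ _ ?_ hc ?_, ?_, ?_⟩
    · refine LSpec.le_iff_res_le.mpr fun x => ?_
      have h3 := abs_le.mp (hb x)
      have h4 : x.res a ≤ g x := h1 x
      rw [LSpec.res_sub, LSpec.res_cst]
      linarith
    · refine LSpec.le_iff_res_le.mpr fun x => ?_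
      have h3 := abs_le.mp (hb x)
      have h4 : g x ≤ x.res b := h2 x
      rw [LSpec.res_add, LSpec.res_cst]
      linarith
    · rw [sub_sub_cancel, abs_of_nonneg (cst_nonneg hε.le)]
    · rw [sub_add_cancel_left, abs_neg, abs_of_nonneg (cst_nonneg hε.le)]

/-- The representation `A → 𝓑𝓒_≤𝓧(A)` of a skeletal proximity `baℓ`-algebra. -/
noncomputable def toBC (hs : spbal A) : A ⟶ functorBC.obj (Opposite.op (A.spec hA)) where
  hom :=
    { (LSpec.gelfand A.carrier).toAlgHom.codRestrict
          (monotoneFunctions (A.spec hA).carrier).env (fun a => by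
        obtain ⟨c, hc, d, hd, rfl⟩ : a ∈ A.skel.env := by
          rw [show A.skel.env = ⊤ from hs]; trivial
        exact ⟨_, A.gelfand_mem_monotoneFunctions hA hc, _,
          A.gelfand_mem_monotoneFunctions hA hd, (map_sub _ c d).symm⟩) with
      map_sup' := fun a b => Subtype.ext ((LSpec.gelfand A.carrier).map_sup' a b)
      map_inf' := fun a b => Subtype.ext ((LSpec.gelfand A.carrier).map_inf' a b) }
  map_prec := fun a b h => by
    obtain ⟨c, hc, h1, h2⟩ := (A.toC hA).map_prec a b h
    exact ⟨⟨c, SbalSub.le_env _ hc⟩, hc, h1, h2⟩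

/-- With a complete skeleton every order-preserving function is exactly the image of a reflexive
element, so both differences and interpolants pull back. -/
lemma isIso_toBC (hs : uspbal A) : IsIso (toBC hA hs.1) := by
  refine isIso_of_bijective _ ?_ (fun a b => LSpec.gelfand_le_iff.mp) ?_
  · rintro ⟨_, f, hf, g, hg, rfl⟩
    obtain ⟨c, -, rfl⟩ := exists_skel_eq hA hs.2 hf
    obtain ⟨d, -, rfl⟩ := exists_skel_eq hA hs.2 hg
    exact ⟨c - d, Subtype.ext (map_sub (LSpec.gelfand A.carrier).toAlgHom c d)⟩
  · rintro a b ⟨g, hg, h1, h2⟩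
    obtain ⟨c, hc, hcg⟩ := exists_skel_eq hA hs.2 hg
    refine A.isReflexiveProximity.mono _ _ _ _ (LSpec.gelfand_le_iff.mp ?_) hc
      (LSpec.gelfand_le_iff.mp ?_)
    · rw [hcg]; exact h1
    · rw [hcg]; exact h2

end Pbal

/-! ### The points of a Nachbin space as maximal `ℓ`-ideals -/

section Points

variable {X : Type*} [TopologicalSpace X] [CompactSpace X] (S : SbalSub C(X, ℝ))

/-- The maximal `ℓ`-ideal of functions vanishing at `p`. -/
def pointIdeal (p : X) : LSpec S.env :=
  ⟨{ carrier := {f | f.1 p = 0}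
     zero_mem' := rfl
     add_mem' := fun {f g} (hf : f.1 p = 0) (hg : g.1 p = 0) => by
       change f.1 p + g.1 p = 0
       rw [hf, hg, add_zero]
     smul_mem' := fun f g (hg : g.1 p = 0) => by
       change f.1 p * g.1 p = 0
       rw [hg, mul_zero] },
    LSpec.maximal_of_residue
      (fun f g h (hg : g.1 p = 0) => by
        have h1 : |f.1 p| ≤ |g.1 p| := h p
        rw [hg, abs_zero] at h1
        exact abs_nonpos_iff.mp h1)
      (fun h => one_ne_zero (α := ℝ) ((Ideal.eq_top_iff_one _).mp h))
      (fun f => ⟨f.1 p, by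
        change f.1 p - cst C(X, ℝ) (f.1 p) p = 0
        rw [cst_apply, sub_self]⟩)⟩

lemma res_pointIdeal (p : X) (f : S.env) : (pointIdeal S p).res f = f.1 p :=
  LSpec.res_eq (by
    change f.1 p - cst C(X, ℝ) (f.1 p) p = 0
    rw [cst_apply, sub_self])

lemma continuous_pointIdeal : Continuous (pointIdeal S) := by
  refine continuous_iff_isClosed.mpr fun Z hZ => ?_
  obtain ⟨I, -, rfl⟩ := LSpec.isClosed_iff.mp hZ
  have h : pointIdeal S ⁻¹' LSpec.zeros I = ⋂ f ∈ I, {p : X | f.1 p = 0} := by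
    ext p
    simp only [Set.mem_iInter]
    exact Iff.rfl
  rw [h]
  exact isClosed_biInter fun f _ => isClosed_eq f.1.continuous continuous_const

/-- If `x` is not a point ideal, maximality gives at each point a member of `x` not vanishing there.
By compactness a finite sum of squares in `x` is bounded below by a positive constant, which would
then lie in `x`. -/
lemma surjective_pointIdeal : Function.Surjective (pointIdeal S) := by
  intro x
  by_contra! hx
  have h1 : ∀ p, ∃ f ∈ x.1, f.1 p ≠ 0 := by
    intro p
    by_contra! h
    exact hx p (Subtype.ext (x.2.eq_of_le (pointIdeal S p).2.prop h).symm)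
  choose f hf hfp using h1
  obtain ⟨t, ht⟩ := CompactSpace.elim_nhds_subcover (fun p => {q | (f p).1 q ≠ 0}) fun p =>
    (isOpen_ne_fun (f p).1.continuous continuous_const).mem_nhds (hfp p)
  let g : S.env := ∑ p ∈ t, f p * f p
  have hg : g ∈ x.1 := sum_mem fun p _ => x.1.mul_mem_left _ (hf p)
  have hgq : ∀ q, g.1 q = ∑ p ∈ t, (f p).1 q * (f p).1 q := by
    intro q
    simp [g]
  have hpos : ∀ q, 0 < g.1 q := by
    intro q
    obtain ⟨p, hp, hq⟩ := Set.exists_set_mem_of_union_eq_top _ _ ht q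
    rw [hgq]
    exact Finset.sum_pos' (fun p _ => mul_self_nonneg _) ⟨p, hp, mul_self_pos.mpr hq⟩
  obtain ⟨ε, hε, hle⟩ : ∃ ε : ℝ, 0 < ε ∧ ∀ q, ε ≤ g.1 q := by
    rcases isEmpty_or_nonempty X with hX | hX
    · exact ⟨1, one_pos, fun q => isEmptyElim q⟩
    · obtain ⟨q, -, hq⟩ := isCompact_univ.exists_isMinOn Set.univ_nonempty
        g.1.continuous.continuousOn
      exact ⟨g.1 q, hpos q, fun q' => hq (Set.mem_univ q')⟩
  refine hε.ne' (LSpec.cst_mem (x := x) (x.mem_of_abs_le (b := g) ?_ hg))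
  rw [abs_of_nonneg (cst_nonneg hε.le)]
  intro q
  change cst C(X, ℝ) ε q ≤ g.1 q
  rw [cst_apply]
  exact hle q

end Points

namespace Nach

variable (X : Nach.{u})

lemma nbal_functorBC (X : Nach.{u}ᵒᵖ) : nbal (functorBC.obj X) :=
  spbal_le_nbal _ (uspbal_functorBC X).1

/-- The maximal `ℓ`-ideal of `𝓑𝓒_≤(X)` of functions vanishing at `p`. -/
def point (p : X.carrier) : LSpec (functorBC.obj (Opposite.op X)).carrier :=
  pointIdeal (monotoneFunctions X.carrier) p

lemma res_point (p : X.carrier) (f : (monotoneFunctions X.carrier).env) :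
    (X.point p).res f = f.1 p :=
  res_pointIdeal _ p f

/-- The skeleton of `𝓑𝓒_≤(X)` is `C_≤(X)`, which determines the order of `X` by Nachbin separation.
-/
lemma point_le_iff {p q : X.carrier} :
    (functorBC.obj (Opposite.op X)).down (X.point q) ⊆ (X.point p).1 ↔ p ≤ q := by
  rw [Pbal.down_subset_iff, le_iff_forall_monotone]
  have hskel : (functorBC.obj (Opposite.op X)).skel = (monotoneFunctions X.carrier).inEnv :=
    skel_envelope _
  rw [hskel]
  exact ⟨fun h f hf => (X.res_point p _).symm.trans_le
      ((h ⟨f, SbalSub.le_env _ hf⟩ hf).trans_eq (X.res_point q _)),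
    fun h f hf => (X.res_point p f).trans_le ((h f.1 hf).trans_eq (X.res_point q f).symm)⟩

/-- The map `X → 𝓧𝓑𝓒_≤(X)` sending a point to the ideal of functions vanishing at it. -/
def toSpec : X ⟶ (functorBC.obj (Opposite.op X)).spec (nbal_functorBC _) where
  toFun := X.point
  monotone' := fun _ _ h => X.point_le_iff.mpr h
  continuous_toFun := continuous_pointIdeal _

/-- Reflecting the order gives injectivity, and a continuous bijection from a compact to a Hausdorff
space is a homeomorphism. -/
lemma isIso_of_bijective {X Y : Nach.{u}} (f : X ⟶ Y)
    (hs : Function.Surjective (ContinuousOrderHom.toContinuousMap f))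
    (hle : ∀ p q, ContinuousOrderHom.toContinuousMap f p ≤ ContinuousOrderHom.toContinuousMap f q →
      p ≤ q) : IsIso f := by
  have hi : Function.Injective (ContinuousOrderHom.toContinuousMap f) := fun p q h =>
    le_antisymm (hle _ _ h.le) (hle _ _ h.ge)
  let e : X.carrier ≃ₜ Y.carrier := Continuous.homeoOfEquivCompactToT2
    (f := Equiv.ofBijective _ ⟨hi, hs⟩) (ContinuousOrderHom.toContinuousMap f).continuous
  have he : ∀ y, ContinuousOrderHom.toContinuousMap f (e.symm y) = y := e.apply_symm_apply
  let g : Y.carrier →Co X.carrier :=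
    { toFun := e.symm
      monotone' := fun y z h => hle _ _ (by rwa [he, he])
      continuous_toFun := e.symm.continuous }
  exact ⟨g, DFunLike.ext (F := X.carrier →Co X.carrier) _ _ e.symm_apply_apply,
    DFunLike.ext (F := Y.carrier →Co Y.carrier) _ _ he⟩

lemma isIso_toSpec : IsIso X.toSpec :=
  isIso_of_bijective _ (surjective_pointIdeal _) fun _ _ => X.point_le_iff.mp

end Nach

/-! ### The adjunction and the equivalences -/

/-- A triangle identity: the elements whose Gelfand transform vanishes at `x` are exactly those of
`x`. -/
lemma toSpec_comp_specMap_toBC {A : Pbal.{u}} (hA : nbal A) (hs : spbal A) :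
    (A.spec hA).toSpec ≫ Pbal.specMap hA (Nach.nbal_functorBC _) (Pbal.toBC hA hs) =
      𝟙 (A.spec hA) :=
  DFunLike.ext (F := (A.spec hA).carrier →Co (A.spec hA).carrier) _ _
    fun (x : LSpec A.carrier) => Subtype.ext (Ideal.ext fun _ =>
      LSpec.res_eq_zero (x := x))

/-- `𝓧 : spbaℓ → Nach`. -/
abbrev spbalX : spbal.{u}.FullSubcategory ⥤ Nach.{u}ᵒᵖ :=
  ObjectProperty.ιOfLE spbal_le_nbal ⋙ functorX

/-- `𝓑𝓒_≤ : Nach → spbaℓ`. -/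
abbrev nachBC : Nach.{u}ᵒᵖ ⥤ spbal.{u}.FullSubcategory :=
  spbal.lift functorBC fun X => uspbal_le_spbal _ (uspbal_functorBC X)

/-- The unit `A → 𝓑𝓒_≤𝓧(A)`. -/
noncomputable def spbalUnit : 𝟭 spbal.{u}.FullSubcategory ⟶ spbalX ⋙ nachBC where
  app A := ObjectProperty.homMk (Pbal.toBC (spbal_le_nbal _ A.property) A.property)
  naturality A B α := by
    refine ObjectProperty.hom_ext _ (Pbal.hom_ext fun (a : A.obj.carrier) =>
      Subtype.ext (ContinuousMap.ext fun (x : LSpec B.obj.carrier) => ?_))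
    change x.res (α.hom.hom.toAlgHom a) = (x.comap α.hom.hom).res a
    refine (LSpec.res_eq ?_).symm
    change α.hom.hom.toAlgHom (a - cst A.obj.carrier _) ∈ x.1
    rw [map_sub, AlgHom.commutes]
    exact x.sub_res_mem _

/-- The counit, given by the maps `X → 𝓧𝓑𝓒_≤(X)`. -/
def spbalCounit : nachBC.{u} ⋙ spbalX ⟶ 𝟭 Nach.{u}ᵒᵖ where
  app X := Quiver.Hom.op X.unop.toSpec
  naturality _ _ _ := rfl

/-- The contravariant adjunction between `spbaℓ` and `Nach`. -/
noncomputable def spbalAdjunction : spbalX.{u} ⊣ nachBC :=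
  Adjunction.mkOfUnitCounit
    { unit := spbalUnit
      counit := spbalCounit
      left_triangle := NatTrans.ext (funext fun A =>
        Quiver.Hom.unop_inj (toSpec_comp_specMap_toBC (spbal_le_nbal _ A.property) A.property))
      right_triangle := NatTrans.ext (funext fun X => ObjectProperty.hom_ext _
        (Pbal.hom_ext fun (f : (monotoneFunctions X.unop.carrier).env) =>
          Subtype.ext (ContinuousMap.ext fun p => X.unop.res_point p f))) }

lemma isIso_spbalUnit_app (A : spbal.{u}.FullSubcategory) (hA : uspbal A.obj) :
    IsIso (spbalUnit.app A) := by
  have : IsIso (spbalUnit.app A).hom := Pbal.isIso_toBC (spbal_le_nbal _ A.property) hA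
  exact (ObjectProperty.isIso_hom_iff _).mp this

instance isIso_spbalCounit_app (X : Nach.{u}ᵒᵖ) : IsIso (spbalCounit.app X) := by
  have := X.unop.isIso_toSpec
  exact isIso_op X.unop.toSpec

/-- `𝓧 : uspbaℓ → Nach`. -/
abbrev uspbalX : uspbal.{u}.FullSubcategory ⥤ Nach.{u}ᵒᵖ :=
  ObjectProperty.ιOfLE uspbal_le_spbal ⋙ spbalX

/-- `𝓑𝓒_≤ : Nach → uspbaℓ`. -/
abbrev nachUBC : Nach.{u}ᵒᵖ ⥤ uspbal.{u}.FullSubcategory := uspbal.lift functorBC uspbal_functorBC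

/-- The dual equivalence between `uspbaℓ` and `Nach`. -/
noncomputable def uspbalEquivalence : uspbal.{u}.FullSubcategory ≌ Nach.{u}ᵒᵖ :=
  CategoryTheory.Equivalence.mk uspbalX nachUBC
    (NatIso.ofComponents (fun A =>
        uspbal.isoMk (X := A) (Y := nachUBC.obj (uspbalX.obj A))
          (@asIso _ _ _ _ (Pbal.toBC (spbal_le_nbal _ A.property.1) A.property.1)
            (Pbal.isIso_toBC _ A.property)))
      fun α => ObjectProperty.hom_ext _ (congrArg (·.hom)
        (spbalUnit.naturality ((ObjectProperty.ιOfLE uspbal_le_spbal).map α))))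
    (NatIso.ofComponents (fun X => asIso (spbalCounit.app X)) fun _ => rfl)

/-! ### The equivalence of `uspbaℓ` and `unbaℓ` -/

/-- `𝓒 : Nach → unbaℓ`. -/
abbrev nachC : Nach.{u}ᵒᵖ ⥤ unbal.{u}.FullSubcategory := unbal.lift functorC unbal_functorC

/-- `𝓑𝓡 : unbaℓ → uspbaℓ`. -/
abbrev unbalBR : unbal.{u}.FullSubcategory ⥤ uspbal.{u}.FullSubcategory :=
  uspbal.lift (unbal.ι ⋙ functorBR) fun A => uspbal_functorBR A.obj A.property

/-- Unital `ℓ`-algebra homomorphisms do not increase the norm, so two that agree on the dense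
subalgebra `𝓑𝓡` agree everywhere. -/
instance : unbalBR.{u}.Faithful where
  map_injective {A B α β} h := by
    refine ObjectProperty.hom_ext _ (Pbal.hom_ext fun a => ?_)
    have hskel : ∀ b ∈ A.obj.skel.env,
        α.hom.hom.toAlgHom b = β.hom.hom.toAlgHom b := by
      intro b hb
      have h1 : functorBR.map α.hom = functorBR.map β.hom := congrArg (·.hom) h
      exact congrArg Subtype.val (congrArg (fun f : functorBR.obj A.obj ⟶ functorBR.obj B.obj =>
        f.hom.toAlgHom ⟨b, hb⟩) h1)
    refine LSpec.eq_iff_res_eq.mpr fun x => eq_of_forall_dist_le fun ε hε => ?_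
    obtain ⟨b, hb, hab⟩ := uniformlyDense_iff.mp A.property.1 a (ε / 2) (half_pos hε)
    have key : ∀ γ : BalHom A.obj.carrier B.obj.carrier,
        |x.res (γ.toAlgHom a) - x.res (γ.toAlgHom b)| ≤ ε / 2 := by
      intro γ
      have h1 := x.res_mono (γ.mono hab)
      rw [γ.map_abs, LSpec.res_abs, map_sub, LSpec.res_sub] at h1
      exact h1.trans_eq ((congrArg x.res (γ.toAlgHom.commutes _)).trans (x.res_cst _))
    have h1 := abs_le.mp (key α.hom.hom)
    have h2 := abs_le.mp (key β.hom.hom)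
    rw [hskel b hb] at h1
    rw [Real.dist_eq, abs_le]
    constructor <;> linarith

/-- Equal `sbal`-subalgebras have isomorphic envelopes. -/
def envelopeCongr {A : Type u} [CommRing A] [Lattice A] [Algebra ℝ A] [IsBal A] {S T : SbalSub A}
    (h : S = T) : envelope S ≅ envelope T where
  hom := envelopeMap
    { AlgHom.id ℝ A with map_sup' := fun _ _ => rfl, map_inf' := fun _ _ => rfl }
    fun _ hs => h ▸ hs
  inv := envelopeMap
    { AlgHom.id ℝ A with map_sup' := fun _ _ => rfl, map_inf' := fun _ _ => rfl }
    fun _ hs => h ▸ hs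
  hom_inv_id := rfl
  inv_hom_id := rfl

/-- The isomorphism `𝓑𝓡𝓒 ≅ 𝓑𝓒_≤`. -/
noncomputable def nachCCompBR : nachC.{u} ⋙ unbalBR ≅ nachUBC :=
  NatIso.ofComponents (fun X => uspbal.isoMk
    (envelopeCongr (SbalSub.skeleton_prec (monotoneFunctions X.unop.carrier))))
    fun _ => rfl

instance : nachUBC.{u}.IsEquivalence := uspbalEquivalence.isEquivalence_inverse

instance : nachC.{u}.Faithful := Functor.Faithful.of_comp_iso nachCCompBR

/-- Fullness descends from the composite `𝓑𝓡𝓒` because its second factor is faithful. -/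
instance : nachC.{u}.Full := Functor.Full.of_comp_faithful_iso nachCCompBR

instance : nachC.{u}.EssSurj where
  mem_essImage A := by
    have := Pbal.isIso_toC A.property.1 A.property
    exact ⟨_, ⟨(unbal.isoMk (asIso (A.obj.toC A.property.1))).symm⟩⟩

instance : nachC.{u}.IsEquivalence where

/-- The equivalence between `uspbaℓ` and `unbaℓ`. -/
noncomputable def unbalEquivalence : uspbal.{u}.FullSubcategory ≌ unbal.{u}.FullSubcategory :=
  let e := uspbalEquivalence.trans nachC.asEquivalence
  -- The composite equivalence has an abstractly chosen inverse. It is isomorphic to `𝓑𝓡` because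
  -- `𝓑𝓡𝓒𝓧 ≅ 𝓑𝓒_≤𝓧 ≅ 𝟭`.
  e.changeInverse (G := unbalBR) <|
    e.inverse.rightUnitor.symm ≪≫
    Functor.isoWhiskerLeft e.inverse (uspbalEquivalence.unitIso ≪≫
      Functor.isoWhiskerLeft uspbalX nachCCompBR.symm) ≪≫
    Functor.isoWhiskerRight e.counitIso unbalBR ≪≫ unbalBR.leftUnitor

end GelfandNachbin

theorem mainTheorem10 :
    ∃ (hspbal : spbal.{u} ≤ nbal.{u})
      (hBC : ∀ X : Nach.{u}ᵒᵖ, uspbal (functorBC.obj X))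
      (hC : ∀ X : Nach.{u}ᵒᵖ, unbal (functorC.obj X))
      (hBR : ∀ A : unbal.{u}.FullSubcategory, uspbal (functorBR.obj A.obj)),
      -- `spbaℓ` is a full subcategory of `nbaℓ`
      ((ObjectProperty.ιOfLE hspbal).Full ∧ (ObjectProperty.ιOfLE hspbal).Faithful) ∧
      -- `𝓧 : spbaℓ → Nach` and `𝓑𝓒_≤ : Nach → spbaℓ` form a contravariant adjunction,
      -- which restricts to a dual equivalence between `uspbaℓ` and `Nach`
      (∃ adj : (ObjectProperty.ιOfLE hspbal ⋙ functorX) ⊣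
            spbal.lift functorBC (fun X => uspbal_le_spbal _ (hBC X)),
          (∀ A : spbal.{u}.FullSubcategory, uspbal A.obj → IsIso (adj.unit.app A)) ∧
          (∀ X : Nach.{u}ᵒᵖ, IsIso (adj.counit.app X))) ∧
      (∃ e : uspbal.{u}.FullSubcategory ≌ Nach.{u}ᵒᵖ,
          e.functor = ObjectProperty.ιOfLE uspbal_le_spbal ⋙
            ObjectProperty.ιOfLE hspbal ⋙ functorX ∧
          e.inverse = uspbal.lift functorBC hBC) ∧
      -- `𝓒𝓧 : uspbaℓ → unbaℓ` and `𝓑𝓡 : unbaℓ → uspbaℓ` form an equivalence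
      (∃ e : uspbal.{u}.FullSubcategory ≌ unbal.{u}.FullSubcategory,
          e.functor = ObjectProperty.ιOfLE uspbal_le_spbal ⋙
            ObjectProperty.ιOfLE hspbal ⋙ functorX ⋙ unbal.lift functorC hC ∧
          e.inverse = uspbal.lift (unbal.ι ⋙ functorBR) hBR) := by
  refine ⟨spbal_le_nbal, uspbal_functorBC, unbal_functorC,
    fun A => uspbal_functorBR A.obj A.property, ⟨inferInstance, inferInstance⟩,
    ⟨spbalAdjunction, isIso_spbalUnit_app, isIso_spbalCounit_app⟩,
    ⟨uspbalEquivalence, rfl, rfl⟩, ⟨unbalEquivalence, rfl, rfl⟩⟩
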